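/- **Theorem.** Let $(\bar M,\varphi,\xi_i,\eta^i,g)$, $i=1,\dots,s$, be a $(2n+s)$-dimensional generalized Kenmotsu manifold. That is, $s\ge 1$; $(\bar M,g)$ is a smooth Riemannian manifold of dimension $2n+s$; $\varphi$ is a smooth $(1,1)$-tensor field, $\xi_i$ are smooth vector fields and $\eta^i$ smooth $1$-forms with $$\varphi^2=-I+\sum_i\eta^i\otimes\xi_i,\quad \eta^i(\xi_j)=\delta_{ij},\quad g(\varphi X,\varphi Y)=g(X,Y)-\sum_i\eta^i(X)\eta^i(Y),$$ $$\eta^i(X)=g(X,\xi_i),\quad g(X,\varphi Y)=-g(\varphi X,Y),\quad \varphi\xi_i=0,\quad \eta^i\circ\varphi=0;$$ and, with $\Phi(X,Y)=g(X,\varphi Y)$, the form $\eta^1\wedge\dots\wedge\eta^s\wedge\Phi^n$ vanishes nowhere, every $\eta^i$ is closed, $d\Phi=2\sum_i\eta^i\wedge\Phi$, and $[\varphi,\varphi]+2\sum_i d\eta^i\otimes\xi_i=0$, where $[\varphi,\varphi]$ is the Nijenhuis tensor of $\varphi$. Let $M$ be an (immersed) invariant submanifold of $\bar M$, i.e. $\varphi(T_xM)\subset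 T_xM$ for all $x\in M$ and every $\xi_i$ is tangent to $M$. For a smooth normal vector field $N$ on $M$ let $A_N$ be the shape operator, defined by the Weingarten formula $\bar\nabla_XN=\nabla^\perp_XN-A_NX$ with $A_NX$ tangent and $\nabla^\perp_XN$ normal to $M$, where $\bar\nabla$ is the Levi-Civita connection of $\bar M$. Then for every smooth normal field $N$ (for which $\varphi N$ is again a normal field), every $i\in\{1,\dots,s\}$ and every vector $X$ tangent to $M$, $$A_N\xi_i=0,\qquad \varphi(A_NX)=A_{\varphi N}X=-A_N(\varphi X).$$ -/

import Mathlib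

open Bundle Manifold ContDiff VectorField Module

noncomputable section

section LeviCivita

set_option linter.unusedSectionVars false

variable {E : Type*} [NormedAddCommGroup E] [NormedSpace ℝ E] [FiniteDimensional ℝ E]
  {M : Type*} [TopologicalSpace M] [ChartedSpace E M] [IsManifold 𝓘(ℝ, E) ∞ M]
  [RiemannianBundle (fun x : M ↦ TangentSpace 𝓘(ℝ, E) x)]
  [IsContMDiffRiemannianBundle 𝓘(ℝ, E) ∞ E (fun x : M ↦ TangentSpace 𝓘(ℝ, E) x)]

/-- The function `x ↦ g(X, Y)(x)`. -/
def metricFun (X Y : Π x : M, TangentSpace 𝓘(ℝ, E) x) (x : M) : ℝ := inner ℝ (X x) (Y x)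

/-- Twice `g(∇_X Y, Z)` at `x`, as given by the Koszul formula. -/
def koszul (Y X Z : Π x : M, TangentSpace 𝓘(ℝ, E) x) (x : M) : ℝ :=
  mvfderiv 𝓘(ℝ, E) (metricFun Y Z) x (X x) + mvfderiv 𝓘(ℝ, E) (metricFun Z X) x (Y x)
    - mvfderiv 𝓘(ℝ, E) (metricFun X Y) x (Z x)
    + inner ℝ (mlieBracket 𝓘(ℝ, E) X Y x) (Z x) - inner ℝ (mlieBracket 𝓘(ℝ, E) Y Z x) (X x)
    + inner ℝ (mlieBracket 𝓘(ℝ, E) Z X x) (Y x)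

variable {X X' Y Z Z' : Π x : M, TangentSpace 𝓘(ℝ, E) x} {x : M} {c : M → ℝ}

lemma metricFun_comm (X Y : Π x : M, TangentSpace 𝓘(ℝ, E) x) :
    metricFun X Y = metricFun Y X := by
  funext x; exact real_inner_comm _ _

lemma metricFun_mdifferentiableAt (hX : MDiffAt (T% X) x) (hY : MDiffAt (T% Y) x) :
    MDiffAt (metricFun X Y) x :=
  MDifferentiableAt.inner_bundle hX hY

lemma mvfderiv_metricFun_add_left (hX : MDiffAt (T% X) x) (hX' : MDiffAt (T% X') x)
    (hY : MDiffAt (T% Y) x) :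
    mvfderiv 𝓘(ℝ, E) (metricFun (X + X') Y) x =
      mvfderiv 𝓘(ℝ, E) (metricFun X Y) x + mvfderiv 𝓘(ℝ, E) (metricFun X' Y) x := by
  have : metricFun (X + X') Y = metricFun X Y + metricFun X' Y := by
    funext y; exact inner_add_left _ _ _
  rw [this, mvfderiv_add (metricFun_mdifferentiableAt hX hY) (metricFun_mdifferentiableAt hX' hY)]

lemma mvfderiv_metricFun_smul_left (hc : MDiffAt c x) (hX : MDiffAt (T% X) x)
    (hY : MDiffAt (T% Y) x) (v : TangentSpace 𝓘(ℝ, E) x) :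
    mvfderiv 𝓘(ℝ, E) (metricFun (c • X) Y) x v =
      c x * mvfderiv 𝓘(ℝ, E) (metricFun X Y) x v
        + mvfderiv 𝓘(ℝ, E) c x v * inner ℝ (X x) (Y x) := by
  have : metricFun (c • X) Y = c * metricFun X Y := by
    funext y; exact real_inner_smul_left _ _ _
  rw [this, mvfderiv_mul hc (metricFun_mdifferentiableAt hX hY)]
  simp [metricFun]
  ring

lemma koszul_tensorial_left (hY : MDiffAt (T% Y) x) (hZ : MDiffAt (T% Z) x) :
    TensorialAt 𝓘(ℝ, E) E (fun X ↦ koszul Y X Z x) x where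
  smul {c X} hc hX := by
    simp only [koszul]
    rw [metricFun_comm Z, metricFun_comm Z, mvfderiv_metricFun_smul_left hc hX hZ,
      mvfderiv_metricFun_smul_left hc hX hY, mlieBracket_smul_left hc hX,
      mlieBracket_smul_right hc hX]
    simp only [Pi.smul_apply', map_smul, smul_eq_mul, inner_add_left, real_inner_smul_left,
      real_inner_smul_right]
    ring
  add {X X'} hX hX' := by
    simp only [koszul]
    rw [metricFun_comm Z, metricFun_comm Z, metricFun_comm Z, mvfderiv_metricFun_add_left hX hX' hZ,
      mvfderiv_metricFun_add_left hX hX' hY, mlieBracket_add_left hX hX',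
      mlieBracket_add_right hX hX']
    simp only [Pi.add_apply, map_add, inner_add_left, inner_add_right, add_apply]
    ring

lemma koszul_tensorial_right (hX : MDiffAt (T% X) x) (hY : MDiffAt (T% Y) x) :
    TensorialAt 𝓘(ℝ, E) E (fun Z ↦ koszul Y X Z x) x where
  smul {c Z} hc hZ := by
    simp only [koszul]
    rw [metricFun_comm Y, mvfderiv_metricFun_smul_left hc hZ hY,
      mvfderiv_metricFun_smul_left hc hZ hX, mlieBracket_smul_left hc hZ,
      mlieBracket_smul_right hc hZ, metricFun_comm Z Y]
    simp only [Pi.smul_apply', map_smul, smul_eq_mul, inner_add_left, real_inner_smul_left,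
      real_inner_smul_right, real_inner_comm (Y x) (Z x), real_inner_comm (X x) (Z x)]
    ring
  add {Z Z'} hZ hZ' := by
    simp only [koszul]
    rw [metricFun_comm Y, metricFun_comm Y, metricFun_comm Y, mvfderiv_metricFun_add_left hZ hZ' hY,
      mvfderiv_metricFun_add_left hZ hZ' hX, mlieBracket_add_left hZ hZ',
      mlieBracket_add_right hZ hZ']
    simp only [Pi.add_apply, map_add, inner_add_left, inner_add_right, add_apply]
    ring

open scoped Classical in
/-- The Levi-Civita connection, on a vector field `Y`: at a point where `Y` is differentiable,
`∇_v Y` is the vector whose inner product with `w` is half of the Koszul expression. (It is `0` by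
convention where `Y` is not differentiable.) -/
def leviCivitaFun (Y : Π x : M, TangentSpace 𝓘(ℝ, E) x) (x : M) :
    TangentSpace 𝓘(ℝ, E) x →L[ℝ] TangentSpace 𝓘(ℝ, E) x :=
  if hY : MDiffAt (T% Y) x then
    have : FiniteDimensional ℝ (TangentSpace 𝓘(ℝ, E) x) := inferInstanceAs (FiniteDimensional ℝ E)
    let K : TangentSpace 𝓘(ℝ, E) x →L[ℝ] TangentSpace 𝓘(ℝ, E) x →L[ℝ] ℝ :=
      TensorialAt.mkHom₂ (fun X Z ↦ koszul Y X Z x) x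
        (fun _ hZ ↦ koszul_tensorial_left hY hZ) (fun _ hX ↦ koszul_tensorial_right hX hY)
    let b := stdOrthonormalBasis ℝ (TangentSpace 𝓘(ℝ, E) x)
    ∑ i, ((1 / 2 : ℝ) • K.flip (b i)).smulRight (b i)
  else 0

lemma inner_leviCivitaFun (hX : MDiffAt (T% X) x) (hY : MDiffAt (T% Y) x)
    (hZ : MDiffAt (T% Z) x) :
    inner ℝ (leviCivitaFun Y x (X x)) (Z x) = (1 / 2 : ℝ) * koszul Y X Z x := by
  have : FiniteDimensional ℝ (TangentSpace 𝓘(ℝ, E) x) := inferInstanceAs (FiniteDimensional ℝ E)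
  have key : ∀ L : TangentSpace 𝓘(ℝ, E) x →L[ℝ] ℝ, ∀ w : TangentSpace 𝓘(ℝ, E) x,
      inner ℝ (∑ i, L (stdOrthonormalBasis ℝ (TangentSpace 𝓘(ℝ, E) x) i) •
        stdOrthonormalBasis ℝ (TangentSpace 𝓘(ℝ, E) x) i) w = L w := by
    intro L w
    conv_rhs => rw [← (stdOrthonormalBasis ℝ (TangentSpace 𝓘(ℝ, E) x)).sum_repr' w]
    simp only [sum_inner, real_inner_smul_left, map_sum, map_smul, smul_eq_mul]
    exact Finset.sum_congr rfl fun i _ ↦ mul_comm _ _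
  rw [leviCivitaFun, dif_pos hY]
  rw [← TensorialAt.mkHom₂_apply (Φ := fun X Z ↦ koszul Y X Z x)
    (fun _ hZ ↦ koszul_tensorial_left hY hZ) (fun _ hX ↦ koszul_tensorial_right hX hY) hX hZ]
  have := key ((1 / 2 : ℝ) • (TensorialAt.mkHom₂ (fun X Z ↦ koszul Y X Z x) x
        (fun _ hZ ↦ koszul_tensorial_left hY hZ) (fun _ hX ↦ koszul_tensorial_right hX hY)) (X x))
        (Z x)
  simpa [sum_apply] using this

/-- Vectors at `x` are separated by inner products with differentiable vector fields. -/
lemma eq_of_inner_field {u v : TangentSpace 𝓘(ℝ, E) x}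
    (h : ∀ Z : Π x : M, TangentSpace 𝓘(ℝ, E) x, MDiffAt (T% Z) x →
      (inner ℝ u (Z x) : ℝ) = inner ℝ v (Z x)) : u = v := by
  refine ext_inner_right ℝ fun w ↦ ?_
  have := h (FiberBundle.extend E w) (FiberBundle.mdifferentiableAt_extend 𝓘(ℝ, E) E w)
  simpa using this

lemma clm_eq_of_inner_field {A B : TangentSpace 𝓘(ℝ, E) x →L[ℝ] TangentSpace 𝓘(ℝ, E) x}
    (h : ∀ X Z : Π x : M, TangentSpace 𝓘(ℝ, E) x, MDiffAt (T% X) x → MDiffAt (T% Z) x →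
      (inner ℝ (A (X x)) (Z x) : ℝ) = inner ℝ (B (X x)) (Z x)) : A = B := by
  ext v
  refine eq_of_inner_field fun Z hZ ↦ ?_
  have := h (FiberBundle.extend E v) Z (FiberBundle.mdifferentiableAt_extend 𝓘(ℝ, E) E v) hZ
  simpa using this

variable (E M) in
/-- The Levi-Civita connection of a Riemannian manifold. -/
def leviCivita : CovariantDerivative 𝓘(ℝ, E) E (fun x : M ↦ TangentSpace 𝓘(ℝ, E) x) where
  toFun := leviCivitaFun
  isCovariantDerivativeOnUniv :=
  { add := by
      intro Y Y' x hY hY' _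
      refine clm_eq_of_inner_field fun X Z hX hZ ↦ ?_
      rw [add_apply, inner_add_left, inner_leviCivitaFun hX hY hZ, inner_leviCivitaFun hX hY' hZ,
        inner_leviCivitaFun hX (mdifferentiableAt_add_section hY hY') hZ]
      simp only [koszul]
      rw [metricFun_comm X, metricFun_comm X, metricFun_comm X,
        mvfderiv_metricFun_add_left hY hY' hZ, mvfderiv_metricFun_add_left hY hY' hX,
        mlieBracket_add_left hY hY', mlieBracket_add_right hY hY']
      simp only [Pi.add_apply, map_add, inner_add_left, inner_add_right, add_apply]
      ring
    leibniz := by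
      intro Y c x hY hc _
      refine clm_eq_of_inner_field fun X Z hX hZ ↦ ?_
      rw [add_apply, inner_add_left, smul_apply, real_inner_smul_left,
        inner_leviCivitaFun hX hY hZ,
        inner_leviCivitaFun hX (hc.smul_section hY) hZ]
      simp only [koszul]
      rw [metricFun_comm X, mvfderiv_metricFun_smul_left hc hY hZ,
        mvfderiv_metricFun_smul_left hc hY hX, mlieBracket_smul_left hc hY,
        mlieBracket_smul_right hc hY, metricFun_comm X Y]
      simp only [Pi.smul_apply', map_smul, smul_eq_mul, inner_add_left, real_inner_smul_left,
        real_inner_smul_right, ContinuousLinearMap.smulRight_apply,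
        real_inner_comm (X x) (Y x)]
      ring }

/-- The Levi-Civita connection is torsion free. -/
theorem leviCivita_torsion : (leviCivita E M).torsion = 0 := by
  rw [CovariantDerivative.torsion_eq_zero_iff]
  intro X Y x hX hY
  refine eq_of_inner_field fun Z hZ ↦ ?_
  rw [inner_sub_left]
  change inner ℝ (leviCivitaFun Y x (X x)) (Z x) - inner ℝ (leviCivitaFun X x (Y x)) (Z x) = _
  rw [inner_leviCivitaFun hX hY hZ, inner_leviCivitaFun hY hX hZ]
  simp only [koszul]
  rw [metricFun_comm X Z, metricFun_comm Z Y, metricFun_comm Y X, mlieBracket_swap (V := Y) (W := X),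
    mlieBracket_swap (V := Z) (W := Y), mlieBracket_swap (V := X) (W := Z)]
  simp only [Pi.neg_apply, inner_neg_left]
  ring

/-- The Levi-Civita connection is compatible with the metric: `X g(Y, Z) = g(∇_X Y, Z) +
g(Y, ∇_X Z)`. -/
theorem leviCivita_metric (hX : MDiffAt (T% X) x) (hY : MDiffAt (T% Y) x) (hZ : MDiffAt (T% Z) x) :
    mvfderiv 𝓘(ℝ, E) (fun y ↦ (inner ℝ (Y y) (Z y) : ℝ)) x (X x) =
      inner ℝ (leviCivita E M Y x (X x)) (Z x) + inner ℝ (Y x) (leviCivita E M Z x (X x)) := by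
  change mvfderiv 𝓘(ℝ, E) (metricFun Y Z) x (X x) =
    inner ℝ (leviCivitaFun Y x (X x)) (Z x) + inner ℝ (Y x) (leviCivitaFun Z x (X x))
  rw [real_inner_comm _ (Y x), inner_leviCivitaFun hX hY hZ, inner_leviCivitaFun hX hZ hY]
  simp only [koszul]
  rw [metricFun_comm X Z, metricFun_comm Z Y, metricFun_comm Y X, mlieBracket_swap (V := Y) (W := X),
    mlieBracket_swap (V := Z) (W := Y), mlieBracket_swap (V := X) (W := Z)]
  simp only [Pi.neg_apply, inner_neg_left]
  ring

end LeviCivita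

section Kenmotsu

set_option linter.unusedSectionVars false

variable {E : Type*} [NormedAddCommGroup E] [NormedSpace ℝ E] [FiniteDimensional ℝ E]
  {M : Type*} [TopologicalSpace M] [ChartedSpace E M] [IsManifold 𝓘(ℝ, E) ∞ M]
  [RiemannianBundle (fun x : M ↦ TangentSpace 𝓘(ℝ, E) x)]
  [IsContMDiffRiemannianBundle 𝓘(ℝ, E) ∞ E (fun x : M ↦ TangentSpace 𝓘(ℝ, E) x)]

variable (E M) in
/-- A metric `f`-structure `(φ, ξ_i, η^i, g)` with `s` structure vector fields on the Riemannian
manifold `M`, whose metric is `g = inner ℝ`. -/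
structure MetricFStructure (s : ℕ) where
  /-- the `(1,1)`-tensor field `φ` -/
  φ : Π x : M, TangentSpace 𝓘(ℝ, E) x →L[ℝ] TangentSpace 𝓘(ℝ, E) x
  /-- the vector fields `ξ_i` -/
  ξ : Fin s → Π x : M, TangentSpace 𝓘(ℝ, E) x
  /-- the `1`-forms `η^i` -/
  η : Fin s → Π x : M, TangentSpace 𝓘(ℝ, E) x →L[ℝ] ℝ
  smooth_φ : ContMDiff 𝓘(ℝ, E) (𝓘(ℝ, E).prod 𝓘(ℝ, E →L[ℝ] E)) ∞ fun x ↦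
    TotalSpace.mk' (E →L[ℝ] E)
      (E := fun y : M ↦ TangentSpace 𝓘(ℝ, E) y →L[ℝ] TangentSpace 𝓘(ℝ, E) y) x (φ x)
  smooth_ξ : ∀ i, ContMDiff 𝓘(ℝ, E) 𝓘(ℝ, E).tangent ∞ (T% (ξ i))
  smooth_η : ∀ i, ContMDiff 𝓘(ℝ, E) (𝓘(ℝ, E).prod 𝓘(ℝ, E →L[ℝ] ℝ)) ∞ fun x ↦
    TotalSpace.mk' (E →L[ℝ] ℝ)
      (E := fun y : M ↦ TangentSpace 𝓘(ℝ, E) y →L[ℝ] Bundle.Trivial M ℝ y) x (η i x)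
  φ_φ : ∀ x u, φ x (φ x u) = -u + ∑ i, η i x u • ξ i x
  η_ξ : ∀ x i j, η i x (ξ j x) = if i = j then 1 else 0
  inner_φ_φ : ∀ x u v, (inner ℝ (φ x u) (φ x v) : ℝ) = inner ℝ u v - ∑ i, η i x u * η i x v
  η_eq : ∀ x i u, η i x u = inner ℝ u (ξ i x)
  inner_φ : ∀ x u v, (inner ℝ u (φ x v) : ℝ) = -inner ℝ (φ x u) v
  φ_ξ : ∀ x i, φ x (ξ i x) = 0
  η_φ : ∀ x i u, η i x (φ x u) = 0

/-- The exterior derivative of a `1`-form,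
`dη(X, Y) = (1/2) (X (η Y) - Y (η X) - η [X, Y])`. -/
def extDeriv₁ (η : Π x : M, TangentSpace 𝓘(ℝ, E) x →L[ℝ] ℝ)
    (X Y : Π x : M, TangentSpace 𝓘(ℝ, E) x) (x : M) : ℝ :=
  (1 / 2) * (mvfderiv 𝓘(ℝ, E) (fun y ↦ η y (Y y)) x (X x)
    - mvfderiv 𝓘(ℝ, E) (fun y ↦ η y (X y)) x (Y x) - η x (mlieBracket 𝓘(ℝ, E) X Y x))

/-- The exterior derivative of a `2`-form `Ω`, with the same normalization:
`dΩ(X, Y, Z)` is a third of the cyclic sum of `X (Ω(Y, Z)) - Ω([X, Y], Z)`. -/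
def extDeriv₂ (Ω : Π x : M, TangentSpace 𝓘(ℝ, E) x → TangentSpace 𝓘(ℝ, E) x → ℝ)
    (X Y Z : Π x : M, TangentSpace 𝓘(ℝ, E) x) (x : M) : ℝ :=
  (1 / 3) * (mvfderiv 𝓘(ℝ, E) (fun y ↦ Ω y (Y y) (Z y)) x (X x)
    + mvfderiv 𝓘(ℝ, E) (fun y ↦ Ω y (Z y) (X y)) x (Y x)
    + mvfderiv 𝓘(ℝ, E) (fun y ↦ Ω y (X y) (Y y)) x (Z x)
    - Ω x (mlieBracket 𝓘(ℝ, E) X Y x) (Z x) - Ω x (mlieBracket 𝓘(ℝ, E) Y Z x) (X x)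
    - Ω x (mlieBracket 𝓘(ℝ, E) Z X x) (Y x))

/-- The wedge product `η ∧ Ω` of a `1`-form and a `2`-form at a point, with the same
normalization. -/
def wedge₁₂ {V : Type*} (η : V → ℝ) (Ω : V → V → ℝ) (u v w : V) : ℝ :=
  (1 / 3) * (η u * Ω v w + η v * Ω w u + η w * Ω u v)

namespace MetricFStructure

variable {s : ℕ} (S : MetricFStructure E M s)

/-- The fundamental `2`-form `Φ(X, Y) = g(X, φ Y)`. -/
def fundamentalForm (x : M) (u v : TangentSpace 𝓘(ℝ, E) x) : ℝ := inner ℝ u (S.φ x v)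

/-- The Nijenhuis tensor `[φ, φ](X, Y) = φ² [X, Y] + [φ X, φ Y] - φ [φ X, Y] - φ [X, φ Y]`. -/
def nijenhuis (X Y : Π x : M, TangentSpace 𝓘(ℝ, E) x) (x : M) : TangentSpace 𝓘(ℝ, E) x :=
  S.φ x (S.φ x (mlieBracket 𝓘(ℝ, E) X Y x))
    + mlieBracket 𝓘(ℝ, E) (fun y ↦ S.φ y (X y)) (fun y ↦ S.φ y (Y y)) x
    - S.φ x (mlieBracket 𝓘(ℝ, E) (fun y ↦ S.φ y (X y)) Y x)
    - S.φ x (mlieBracket 𝓘(ℝ, E) X (fun y ↦ S.φ y (Y y)) x)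

/-- Normality: `[φ, φ] + 2 ∑ i, dη^i ⊗ ξ_i = 0`. -/
def IsNormal : Prop :=
  ∀ (x : M) (X Y : Π x : M, TangentSpace 𝓘(ℝ, E) x), MDiffAt (T% X) x → MDiffAt (T% Y) x →
    S.nijenhuis X Y x + (2 : ℝ) • ∑ i, extDeriv₁ (S.η i) X Y x • S.ξ i x = 0

/-- The value of `η^1 ∧ ⋯ ∧ η^s ∧ Φ^n` at `x` on the vectors `v`, up to a nonzero constant factor
that depends only on `n` and `s`: the antisymmetrization of
`η^1 ⊗ ⋯ ⊗ η^s ⊗ Φ ⊗ ⋯ ⊗ Φ`. -/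
def topForm (n : ℕ) (x : M) (v : Fin s ⊕ Fin n × Fin 2 → TangentSpace 𝓘(ℝ, E) x) : ℝ :=
  ∑ σ : Equiv.Perm (Fin s ⊕ Fin n × Fin 2), ((Equiv.Perm.sign σ : ℤ) : ℝ) *
    ((∏ i, S.η i x (v (σ (Sum.inl i)))) *
      ∏ k, S.fundamentalForm x (v (σ (Sum.inr (k, 0)))) (v (σ (Sum.inr (k, 1)))))

/-- `M` is an almost `s`-contact metric manifold of dimension `2n + s`, that is,
`η^1 ∧ ⋯ ∧ η^s ∧ Φ^n` vanishes nowhere. -/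
structure IsAlmostSContact (n : ℕ) : Prop where
  finrank_eq : finrank ℝ E = 2 * n + s
  topForm_ne_zero : ∀ x : M, ∃ v, S.topForm n x v ≠ 0

/-- `M` is a generalized almost Kenmotsu manifold of dimension `2n + s`: `s ≥ 1`, the forms `η^i`
are closed, and `dΦ = 2 ∑ i, η^i ∧ Φ`. -/
structure IsGeneralizedAlmostKenmotsu (n : ℕ) : Prop extends S.IsAlmostSContact n where
  one_le : 1 ≤ s
  closed : ∀ (i : Fin s) (x : M) (X Y : Π x : M, TangentSpace 𝓘(ℝ, E) x),
    MDiffAt (T% X) x → MDiffAt (T% Y) x → extDeriv₁ (S.η i) X Y x = 0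
  extDeriv_fundamentalForm : ∀ (x : M) (X Y Z : Π x : M, TangentSpace 𝓘(ℝ, E) x),
    MDiffAt (T% X) x → MDiffAt (T% Y) x → MDiffAt (T% Z) x →
    extDeriv₂ S.fundamentalForm X Y Z x =
      2 * ∑ i, wedge₁₂ (S.η i x) (S.fundamentalForm x) (X x) (Y x) (Z x)

/-- `M` is a generalized Kenmotsu manifold of dimension `2n + s`: generalized almost Kenmotsu and
normal. -/
structure IsGeneralizedKenmotsu (n : ℕ) : Prop extends S.IsGeneralizedAlmostKenmotsu n where
  normal : S.IsNormal

end MetricFStructure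

end Kenmotsu

section Submanifold

set_option linter.unusedSectionVars false

variable {E : Type*} [NormedAddCommGroup E] [NormedSpace ℝ E] [FiniteDimensional ℝ E]
  {M : Type*} [TopologicalSpace M] [ChartedSpace E M] [IsManifold 𝓘(ℝ, E) ∞ M]
  [RiemannianBundle (fun x : M ↦ TangentSpace 𝓘(ℝ, E) x)]
  [IsContMDiffRiemannianBundle 𝓘(ℝ, E) ∞ E (fun x : M ↦ TangentSpace 𝓘(ℝ, E) x)]
  {F : Type*} [NormedAddCommGroup F] [NormedSpace ℝ F] [FiniteDimensional ℝ F]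
  {P : Type*} [TopologicalSpace P] [ChartedSpace F P] [IsManifold 𝓘(ℝ, F) ∞ P]

variable (E F) in
/-- The map `f : P → M` makes `P` an (immersed) submanifold of `M`. Embedded submanifolds are the
special case where `f` is moreover a topological embedding. -/
structure IsImmersedSubmanifold (f : P → M) : Prop where
  smooth : ContMDiff 𝓘(ℝ, F) 𝓘(ℝ, E) ∞ f
  injective : ∀ p, Function.Injective (mfderiv 𝓘(ℝ, F) 𝓘(ℝ, E) f p)

variable (E F) in
/-- The covariant derivative `∇_X V` along `f` of a vector field `V` along `f` (that is,
`V p ∈ T_{f p} M`), at `p`, in the direction `X ∈ T_p P`, for the Levi-Civita connection `∇` of `M`.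
If `e_a` are the vector fields on `M` near `f p` that are constant in the trivialization of `TM` at
`f p`, and `V = ∑ V^a (e_a ∘ f)`, this is `∑ (X V^a) e_a + V^a ∇_{df X} e_a`; the first sum is the
derivative of `V` read in that trivialization, whose fibre over `f p` is identified with `E`. -/
def covAlong (f : P → M) (V : Π p : P, TangentSpace 𝓘(ℝ, E) (f p)) (p : P) :
    TangentSpace 𝓘(ℝ, F) p →L[ℝ] TangentSpace 𝓘(ℝ, E) (f p) :=
  let e := trivializationAt E (TangentSpace 𝓘(ℝ, E) : M → Type _) (f p)
  (e.symmL ℝ (f p)).comp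
      (mvfderiv 𝓘(ℝ, F) (fun q ↦ (e (TotalSpace.mk' E (f q) (V q))).2) p)
    + (leviCivita E M (FiberBundle.extend E (V p)) (f p)).comp (mfderiv 𝓘(ℝ, F) 𝓘(ℝ, E) f p)

lemma leviCivita_eq_of_trivialization {Y : Π x : M, TangentSpace 𝓘(ℝ, E) x} {x : M}
    (hY : MDiffAt (T% Y) x) :
    letI e := trivializationAt E (TangentSpace 𝓘(ℝ, E) : M → Type _) x
    leviCivita E M Y x = (e.symmL ℝ x).comp
        (mvfderiv 𝓘(ℝ, E) (fun y ↦ (e (TotalSpace.mk' E y (Y y))).2) x)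
      + leviCivita E M (FiberBundle.extend E (Y x)) x := by
  set e := trivializationAt E (TangentSpace 𝓘(ℝ, E) : M → Type _) x with he
  have hx : x ∈ e.baseSet := FiberBundle.mem_baseSet_trivializationAt' x
  have hev : ∀ᶠ y in nhds x, y ∈ e.baseSet := e.open_baseSet.mem_nhds hx
  have hd : ∀ {Z : Π x : M, TangentSpace 𝓘(ℝ, E) x}, MDiffAt (T% Z) x →
      MDiffAt (fun y ↦ (e (TotalSpace.mk' E y (Z y))).2) x := fun hZ ↦
    (mdifferentiableAt_section _ _).1 hZ
  let Φ : (Π x : M, TangentSpace 𝓘(ℝ, E) x) →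
      TangentSpace 𝓘(ℝ, E) x →L[ℝ] TangentSpace 𝓘(ℝ, E) x := fun Z ↦
    leviCivita E M Z x - (e.symmL ℝ x).comp
        (mvfderiv 𝓘(ℝ, E) (fun y ↦ (e (TotalSpace.mk' E y (Z y))).2) x)
  have hcongr : ∀ {g g' : M → E}, g =ᶠ[nhds x] g' →
      mvfderiv 𝓘(ℝ, E) g x = mvfderiv 𝓘(ℝ, E) g' x := by
    intro g g' h
    ext v
    simp only [mvfderiv, ContinuousLinearMap.comp_apply]
    rw [h.mfderiv_eq]
    rfl
  have hΦ : TensorialAt 𝓘(ℝ, E) E Φ x :=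
  { smul := by
      intro c Z hc hZ
      have h1 : mvfderiv 𝓘(ℝ, E) (fun y ↦ (e (TotalSpace.mk' E y ((c • Z) y))).2) x =
          mvfderiv 𝓘(ℝ, E) (c • fun y ↦ (e (TotalSpace.mk' E y (Z y))).2) x :=
        hcongr <| hev.mono fun y hy ↦ (e.linear ℝ hy).2 (c y) (Z y)
      simp only [Φ]
      rw [h1, mvfderiv_smul hc (hd hZ),
        (leviCivita E M).isCovariantDerivativeOnUniv.leibniz hZ hc]
      ext v
      have h2 : e.symmL ℝ x (e (TotalSpace.mk' E x (Z x))).2 = Z x :=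
        (e.symmL_apply hx _).trans (e.symm_apply_apply_mk hx (Z x))
      simp [h2, smul_sub]
    add := by
      intro Z Z' hZ hZ'
      have h1 : mvfderiv 𝓘(ℝ, E) (fun y ↦ (e (TotalSpace.mk' E y ((Z + Z') y))).2) x =
          mvfderiv 𝓘(ℝ, E) ((fun y ↦ (e (TotalSpace.mk' E y (Z y))).2) +
            fun y ↦ (e (TotalSpace.mk' E y (Z' y))).2) x :=
        hcongr <| hev.mono fun y hy ↦ (e.linear ℝ hy).1 (Z y) (Z' y)
      simp only [Φ]
      rw [h1, mvfderiv_add (hd hZ) (hd hZ'),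
        (leviCivita E M).isCovariantDerivativeOnUniv.add hZ hZ', ContinuousLinearMap.comp_add]
      abel }
  have h := hΦ.pointwise hY (FiberBundle.mdifferentiableAt_extend 𝓘(ℝ, E) E (Y x))
    (FiberBundle.extend_apply_self E (Y x)).symm
  have h0 : mvfderiv 𝓘(ℝ, E)
      (fun y ↦ (e (TotalSpace.mk' E y (FiberBundle.extend E (Y x) y))).2) x = 0 := by
    rw [hcongr (g' := fun _ ↦ (e (TotalSpace.mk' E x (Y x))).2), mvfderiv_const]
    filter_upwards [hev] with y hy
    simp only [FiberBundle.extend, ← he]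
    have h3 := congrArg Prod.snd (e.apply_mk_symm hy (e (TotalSpace.mk' E x (Y x))).2)
    exact h3
  simp only [Φ, h0, ContinuousLinearMap.comp_zero, sub_zero] at h
  rw [← h]
  abel

/-- If `V = Y ∘ f` for a vector field `Y` on `M`, then `∇_X V = ∇_{df X} Y`. -/
theorem covAlong_comp (f : P → M) (Y : Π x : M, TangentSpace 𝓘(ℝ, E) x) (p : P)
    (hf : MDifferentiableAt 𝓘(ℝ, F) 𝓘(ℝ, E) f p) (hY : MDiffAt (T% Y) (f p)) :
    covAlong E F f (fun q ↦ Y (f q)) p =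
      (leviCivita E M Y (f p)).comp (mfderiv 𝓘(ℝ, F) 𝓘(ℝ, E) f p) := by
  have hd := (mdifferentiableAt_section _ _).1 hY
  rw [leviCivita_eq_of_trivialization hY, covAlong, ContinuousLinearMap.add_comp]
  congr 1
  ext v
  simp only [ContinuousLinearMap.comp_apply, mvfderiv]
  have := mfderiv_comp_apply p hd hf v
  simp only [Function.comp_def] at this
  rw [this]

/-- The tangential part of `w ∈ T_{f p} M`, as a vector in `T_p P`: the vector whose image under
`df` is the orthogonal projection of `w` to the range of `df`. -/
def IsImmersedSubmanifold.tangentialPart {f : P → M} (hf : IsImmersedSubmanifold E F f) (p : P) :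
    TangentSpace 𝓘(ℝ, E) (f p) →ₗ[ℝ] TangentSpace 𝓘(ℝ, F) p :=
  have : FiniteDimensional ℝ (TangentSpace 𝓘(ℝ, E) (f p)) :=
    inferInstanceAs (FiniteDimensional ℝ E)
  let df : TangentSpace 𝓘(ℝ, F) p →ₗ[ℝ] TangentSpace 𝓘(ℝ, E) (f p) :=
    (mfderiv 𝓘(ℝ, F) 𝓘(ℝ, E) f p).toLinearMap
  (LinearEquiv.ofInjective df (hf.injective p)).symm.toLinearMap ∘ₗ
    (LinearMap.range df).orthogonalProjectionOnto.toLinearMap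

lemma IsImmersedSubmanifold.inner_tangentialPart {f : P → M} (hf : IsImmersedSubmanifold E F f)
    (p : P) (w : TangentSpace 𝓘(ℝ, E) (f p)) (u : TangentSpace 𝓘(ℝ, F) p) :
    (inner ℝ (mfderiv 𝓘(ℝ, F) 𝓘(ℝ, E) f p (hf.tangentialPart p w))
      (mfderiv 𝓘(ℝ, F) 𝓘(ℝ, E) f p u) : ℝ) = inner ℝ w (mfderiv 𝓘(ℝ, F) 𝓘(ℝ, E) f p u) := by
  have : FiniteDimensional ℝ (TangentSpace 𝓘(ℝ, E) (f p)) :=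
    inferInstanceAs (FiniteDimensional ℝ E)
  set df : TangentSpace 𝓘(ℝ, F) p →ₗ[ℝ] TangentSpace 𝓘(ℝ, E) (f p) :=
    (mfderiv 𝓘(ℝ, F) 𝓘(ℝ, E) f p).toLinearMap with hdf
  have h1 : df (hf.tangentialPart p w) =
      ((LinearMap.range df).orthogonalProjectionOnto w : TangentSpace 𝓘(ℝ, E) (f p)) :=
    congrArg Subtype.val ((LinearEquiv.ofInjective df (hf.injective p)).apply_symm_apply
      ((LinearMap.range df).orthogonalProjectionOnto w))
  change inner ℝ (df _) (df u) = inner ℝ w (df u)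
  rw [h1]
  exact (LinearMap.range df).inner_orthogonalProjectionOnto_eq_of_mem_right
    ⟨df u, LinearMap.mem_range_self df u⟩ w

lemma IsImmersedSubmanifold.mfderiv_tangentialPart {f : P → M} (hf : IsImmersedSubmanifold E F f)
    (p : P) {w : TangentSpace 𝓘(ℝ, E) (f p)} (hw : ∃ u, mfderiv 𝓘(ℝ, F) 𝓘(ℝ, E) f p u = w) :
    mfderiv 𝓘(ℝ, F) 𝓘(ℝ, E) f p (hf.tangentialPart p w) = w := by
  obtain ⟨u, rfl⟩ := hw
  have h := hf.inner_tangentialPart p (mfderiv 𝓘(ℝ, F) 𝓘(ℝ, E) f p u)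
  rw [← sub_eq_zero, ← map_sub, ← inner_self_eq_zero (𝕜 := ℝ)]
  conv_lhs => arg 2; rw [map_sub]
  rw [inner_sub_left, h, sub_self]

variable (E F) in
/-- A smooth section of the normal bundle of the submanifold `f : P → M`. -/
structure NormalField (f : P → M) where
  toFun : Π p : P, TangentSpace 𝓘(ℝ, E) (f p)
  smooth : ContMDiff 𝓘(ℝ, F) 𝓘(ℝ, E).tangent ∞
    fun p ↦ (TotalSpace.mk' E (f p) (toFun p) : TangentBundle 𝓘(ℝ, E) M)
  normal : ∀ p u, (inner ℝ (toFun p) (mfderiv 𝓘(ℝ, F) 𝓘(ℝ, E) f p u) : ℝ) = 0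

/-- The shape operator `A_N` at `p`: by the Weingarten formula `∇_X N = ∇^⊥_X N - A_N X`, the vector
`A_N X` is minus the tangential part of `∇_X N`. -/
def shapeOperator {f : P → M} (hf : IsImmersedSubmanifold E F f) (N : NormalField E F f) (p : P) :
    TangentSpace 𝓘(ℝ, F) p →ₗ[ℝ] TangentSpace 𝓘(ℝ, F) p :=
  -(hf.tangentialPart p ∘ₗ (covAlong E F f N.toFun p).toLinearMap)

/-- `f : P → M` is an invariant submanifold: `φ (T_p P) ⊆ T_p P`, and the `ξ_i` are tangent
to `P`. -/
structure IsInvariantSubmanifold {s : ℕ} (S : MetricFStructure E M s) (f : P → M) : Prop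
    extends IsImmersedSubmanifold E F f where
  φ_tangent : ∀ (p : P) (u : TangentSpace 𝓘(ℝ, F) p),
    ∃ v, mfderiv 𝓘(ℝ, F) 𝓘(ℝ, E) f p v = S.φ (f p) (mfderiv 𝓘(ℝ, F) 𝓘(ℝ, E) f p u)
  ξ_tangent : ∀ (p : P) (i : Fin s), ∃ v, mfderiv 𝓘(ℝ, F) 𝓘(ℝ, E) f p v = S.ξ i (f p)

namespace IsInvariantSubmanifold

variable {s : ℕ} {S : MetricFStructure E M s} {f : P → M}

/-- The restriction of `φ` to `T_p P`. -/
def φ (hf : IsInvariantSubmanifold (F := F) S f) (p : P) :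
    TangentSpace 𝓘(ℝ, F) p →ₗ[ℝ] TangentSpace 𝓘(ℝ, F) p :=
  hf.tangentialPart p ∘ₗ (S.φ (f p)).toLinearMap ∘ₗ (mfderiv 𝓘(ℝ, F) 𝓘(ℝ, E) f p).toLinearMap

/-- The vector field `ξ_i`, as a vector field on `P`. -/
def ξ (hf : IsInvariantSubmanifold (F := F) S f) (i : Fin s) (p : P) : TangentSpace 𝓘(ℝ, F) p :=
  hf.tangentialPart p (S.ξ i (f p))

lemma mfderiv_φ (hf : IsInvariantSubmanifold (F := F) S f) (p : P) (u : TangentSpace 𝓘(ℝ, F) p) :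
    mfderiv 𝓘(ℝ, F) 𝓘(ℝ, E) f p (hf.φ p u) = S.φ (f p) (mfderiv 𝓘(ℝ, F) 𝓘(ℝ, E) f p u) :=
  hf.mfderiv_tangentialPart p (hf.φ_tangent p u)

lemma mfderiv_ξ (hf : IsInvariantSubmanifold (F := F) S f) (i : Fin s) (p : P) :
    mfderiv 𝓘(ℝ, F) 𝓘(ℝ, E) f p (hf.ξ i p) = S.ξ i (f p) :=
  hf.mfderiv_tangentialPart p (hf.ξ_tangent p i)

/-- The normal field `φ N`. -/
def φNormal (hf : IsInvariantSubmanifold (F := F) S f) (N : NormalField E F f) :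
    NormalField E F f where
  toFun p := S.φ (f p) (N.toFun p)
  smooth := (S.smooth_φ.comp hf.smooth).clm_bundle_apply N.smooth
  normal p u := by
    rw [← neg_eq_iff_eq_neg.mpr (S.inner_φ (f p) _ _), ← hf.mfderiv_φ, N.normal, neg_zero]

end IsInvariantSubmanifold

end Submanifold

end

/-! Everything follows from one formula for the ambient manifold,
`IsGeneralizedKenmotsu.inner_nablaφ`: `(∇_v φ) u = ∑ i, (g(φ v, u) ξ_i - η^i(u) φ v)`. Since the
`η^i` are closed, normality says that the Nijenhuis tensor vanishes. The classical identity `2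
g((∇_X φ) Y, Z) = 3 dΦ(X, φ Y, φ Z) - 3 dΦ(X, Y, Z)` then holds (`two_mul_eq_cyclic_sub_cyclic`),
and `dΦ = 2 ∑ i, η^i ∧ Φ` is substituted.

On an invariant submanifold `φ X` and the `ξ_i` are tangent. For `N` normal this makes `g(φ X, N)`
and `η^i(N)` zero, so `(∇_X φ) N = 0` and `∇_X (φ N) = φ (∇_X N)`. Tangential parts give `A_{φ N} =
φ A_N`. The second equality uses that `A_N` and `A_{φ N}` are self-adjoint
(`NormalField.inner_covAlong_comm`) and `φ` is skew. Finally `g(A_N ξ_i, X) = g(A_N X, ξ_i) = g(N,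
∇_X ξ_i)`, which vanishes by the formula for `∇φ` applied to `ξ_i`.

Normal fields live only along the immersion `f`, so the induced connection `covAlong` needs its own
Leibniz rules. These are reduced to vector fields on `M` by `MDiffAlongAt.induction`. -/

noncomputable section

/-! ### The covariant derivative of `φ` on a metric `f`-manifold. -/

section KenmotsuTensor

set_option linter.unusedSectionVars false

variable {E : Type*} [NormedAddCommGroup E] [NormedSpace ℝ E] [FiniteDimensional ℝ E]
  {M : Type*} [TopologicalSpace M] [ChartedSpace E M] [IsManifold 𝓘(ℝ, E) ∞ M]
  [RiemannianBundle (fun x : M ↦ TangentSpace 𝓘(ℝ, E) x)]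
  [IsContMDiffRiemannianBundle 𝓘(ℝ, E) ∞ E (fun x : M ↦ TangentSpace 𝓘(ℝ, E) x)]

/-- Pointwise form of `[X, Y] = ∇_X Y - ∇_Y X`. -/
lemma mlieBracket_eq_leviCivita_sub {X Y : Π x : M, TangentSpace 𝓘(ℝ, E) x} {x : M}
    (hX : MDiffAt (T% X) x) (hY : MDiffAt (T% Y) x) :
    mlieBracket 𝓘(ℝ, E) X Y x = leviCivita E M Y x (X x) - leviCivita E M X x (Y x) :=
  ((CovariantDerivative.torsion_eq_zero_iff _).1 leviCivita_torsion hX hY).symm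

/-- Metric compatibility of the Levi-Civita connection, for a tangent vector. -/
lemma mvfderiv_inner_leviCivita {Y Z : Π x : M, TangentSpace 𝓘(ℝ, E) x} {x : M}
    (hY : MDiffAt (T% Y) x) (hZ : MDiffAt (T% Z) x) (v : TangentSpace 𝓘(ℝ, E) x) :
    mvfderiv 𝓘(ℝ, E) (fun y ↦ (inner ℝ (Y y) (Z y) : ℝ)) x v =
      inner ℝ (leviCivita E M Y x v) (Z x) + inner ℝ (Y x) (leviCivita E M Z x v) := by
  have := leviCivita_metric (FiberBundle.mdifferentiableAt_extend 𝓘(ℝ, E) E v) hY hZ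
  simpa using this

lemma mvfderiv_finset_sum {ι : Type*} (t : Finset ι) {u : ι → M → ℝ} {x : M}
    (hu : ∀ i ∈ t, MDiffAt (u i) x) :
    MDiffAt (∑ i ∈ t, u i) x ∧
      mvfderiv 𝓘(ℝ, E) (∑ i ∈ t, u i) x = ∑ i ∈ t, mvfderiv 𝓘(ℝ, E) (u i) x := by
  classical
  induction t using Finset.induction_on with
  | empty =>
    simp only [Finset.sum_empty]
    exact ⟨mdifferentiableAt_const, mvfderiv_zero⟩
  | insert a t ha ih =>
    obtain ⟨h1, h2⟩ := ih fun i hi ↦ hu i (Finset.mem_insert_of_mem hi)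
    have h3 := hu a (Finset.mem_insert_self a t)
    rw [Finset.sum_insert ha, Finset.sum_insert ha, mvfderiv_add h3 h1, h2]
    exact ⟨h3.add h1, rfl⟩

namespace MetricFStructure

variable {s : ℕ} (S : MetricFStructure E M s) {x : M}
  {X Y Z : Π x : M, TangentSpace 𝓘(ℝ, E) x}

lemma mdifferentiableAt_φ (hY : MDiffAt (T% Y) x) : MDiffAt (T% (fun y ↦ S.φ y (Y y))) x :=
  ((S.smooth_φ x).mdifferentiableAt (by simp)).clm_bundle_apply hY

lemma mdifferentiableAt_ξ (i : Fin s) : MDiffAt (T% (S.ξ i)) x :=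
  (S.smooth_ξ i x).mdifferentiableAt (by simp)

/-- Replacing `Y` by `c • Y` produces the term `dc ⊗ φ Y` in both summands, and these cancel. -/
lemma tensorialAt_nablaφ (x : M) :
    TensorialAt 𝓘(ℝ, E) E (fun Y ↦ leviCivita E M (fun y ↦ S.φ y (Y y)) x
      - (S.φ x).comp (leviCivita E M Y x)) x where
  smul {c Y} hc hY := by
    have h1 : (fun y ↦ S.φ y ((c • Y) y)) = c • fun y ↦ S.φ y (Y y) := by
      funext y; simp
    rw [h1, (leviCivita E M).isCovariantDerivativeOnUniv.leibniz hY hc,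
      (leviCivita E M).isCovariantDerivativeOnUniv.leibniz (S.mdifferentiableAt_φ hY) hc]
    ext v
    simp [smul_sub]
  add {Y Y'} hY hY' := by
    have h1 : (fun y ↦ S.φ y ((Y + Y') y)) = (fun y ↦ S.φ y (Y y)) + fun y ↦ S.φ y (Y' y) := by
      funext y; simp
    rw [h1, (leviCivita E M).isCovariantDerivativeOnUniv.add hY hY',
      (leviCivita E M).isCovariantDerivativeOnUniv.add (S.mdifferentiableAt_φ hY)
        (S.mdifferentiableAt_φ hY'), ContinuousLinearMap.comp_add]
    abel

/-- The covariant derivative of `φ`: `S.nablaφ x w v` is `(∇_v φ) w`. -/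
def nablaφ (x : M) : TangentSpace 𝓘(ℝ, E) x →L[ℝ]
    TangentSpace 𝓘(ℝ, E) x →L[ℝ] TangentSpace 𝓘(ℝ, E) x :=
  TensorialAt.mkHom _ x (S.tensorialAt_nablaφ x)

lemma nablaφ_apply (hY : MDiffAt (T% Y) x) (v : TangentSpace 𝓘(ℝ, E) x) :
    S.nablaφ x (Y x) v =
      leviCivita E M (fun y ↦ S.φ y (Y y)) x v - S.φ x (leviCivita E M Y x v) := by
  rw [nablaφ, TensorialAt.mkHom_apply _ hY]
  rfl

/-- `∇_v (φ Y) = (∇_v φ) Y + φ (∇_v Y)`. -/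
lemma leviCivita_φ (hY : MDiffAt (T% Y) x) (v : TangentSpace 𝓘(ℝ, E) x) :
    leviCivita E M (fun y ↦ S.φ y (Y y)) x v =
      S.nablaφ x (Y x) v + S.φ x (leviCivita E M Y x v) := by
  rw [S.nablaφ_apply hY]; abel

lemma inner_φ_left (x : M) (u v : TangentSpace 𝓘(ℝ, E) x) :
    (inner ℝ (S.φ x u) v : ℝ) = -inner ℝ u (S.φ x v) := by
  rw [S.inner_φ, neg_neg]

/-- `(∇_v φ)` is skew-symmetric. -/
lemma inner_nablaφ_skew (v u w : TangentSpace 𝓘(ℝ, E) x) :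
    (inner ℝ (S.nablaφ x u v) w : ℝ) = -inner ℝ (S.nablaφ x w v) u := by
  set U := FiberBundle.extend E u with hU
  set W := FiberBundle.extend E w with hW
  have dU : MDiffAt (T% U) x := FiberBundle.mdifferentiableAt_extend 𝓘(ℝ, E) E u
  have dW : MDiffAt (T% W) x := FiberBundle.mdifferentiableAt_extend 𝓘(ℝ, E) E w
  have eU : U x = u := by simp [hU]
  have eW : W x = w := by simp [hW]
  have h : (fun y ↦ (inner ℝ (S.φ y (U y)) (W y) : ℝ)) =
      -fun y ↦ (inner ℝ (U y) (S.φ y (W y)) : ℝ) := by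
    funext y; exact S.inner_φ_left y _ _
  have h1 := congrArg (fun F : M → ℝ ↦ mvfderiv 𝓘(ℝ, E) F x v) h
  simp only [mvfderiv_neg, neg_apply] at h1
  -- The terms containing `∇U` and `∇W` cancel because `φ` itself is skew; only `∇φ` remains.
  rw [mvfderiv_inner_leviCivita (S.mdifferentiableAt_φ dU) dW,
    mvfderiv_inner_leviCivita dU (S.mdifferentiableAt_φ dW), S.leviCivita_φ dU,
    S.leviCivita_φ dW, eU, eW, inner_add_left, inner_add_right, S.inner_φ_left,
    S.inner_φ_left] at h1
  rw [real_inner_comm u (S.nablaφ x w v)]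
  linarith

/-- `(∇_v φ) ξ_i = -φ (∇_v ξ_i)`. -/
lemma nablaφ_ξ (i : Fin s) (v : TangentSpace 𝓘(ℝ, E) x) :
    S.nablaφ x (S.ξ i x) v = -S.φ x (leviCivita E M (S.ξ i) x v) := by
  rw [S.nablaφ_apply (S.mdifferentiableAt_ξ i)]
  have : (fun y ↦ S.φ y (S.ξ i y)) = 0 := by funext y; exact S.φ_ξ y i
  rw [this, CovariantDerivative.zero]
  simp

/-- The derivative of the identity `g(φ Y, φ Z) = g(Y, Z) - ∑ i, η^i(Y) η^i(Z)`. -/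
lemma inner_nablaφ_φ (v u w : TangentSpace 𝓘(ℝ, E) x) :
    (inner ℝ (S.nablaφ x u v) (S.φ x w) + inner ℝ (S.nablaφ x w v) (S.φ x u) : ℝ) =
      -∑ i, S.η i x w * inner ℝ (leviCivita E M (S.ξ i) x v) u
      - ∑ i, S.η i x u * inner ℝ (leviCivita E M (S.ξ i) x v) w := by
  set U := FiberBundle.extend E u with hU
  set W := FiberBundle.extend E w with hW
  have dU : MDiffAt (T% U) x := FiberBundle.mdifferentiableAt_extend 𝓘(ℝ, E) E u
  have dW : MDiffAt (T% W) x := FiberBundle.mdifferentiableAt_extend 𝓘(ℝ, E) E w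
  have eU : U x = u := by simp [hU]
  have eW : W x = w := by simp [hW]
  have mU : ∀ i, MDiffAt (fun y ↦ (inner ℝ (U y) (S.ξ i y) : ℝ)) x := fun i ↦
    metricFun_mdifferentiableAt dU (S.mdifferentiableAt_ξ i)
  have mW : ∀ i, MDiffAt (fun y ↦ (inner ℝ (W y) (S.ξ i y) : ℝ)) x := fun i ↦
    metricFun_mdifferentiableAt dW (S.mdifferentiableAt_ξ i)
  have h : (fun y ↦ (inner ℝ (S.φ y (U y)) (S.φ y (W y)) : ℝ)) =
      (fun y ↦ (inner ℝ (U y) (W y) : ℝ)) -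
        ∑ i, (fun y ↦ (inner ℝ (U y) (S.ξ i y) : ℝ)) * fun y ↦ (inner ℝ (W y) (S.ξ i y) : ℝ) := by
    funext y
    simp [S.inner_φ_φ, S.η_eq]
  have hs := mvfderiv_finset_sum (E := E) (x := x) Finset.univ
    (u := fun i ↦ (fun y ↦ (inner ℝ (U y) (S.ξ i y) : ℝ)) * fun y ↦ (inner ℝ (W y) (S.ξ i y) : ℝ))
    fun i _ ↦ (mU i).mul (mW i)
  have h1 := congrArg (fun F : M → ℝ ↦ mvfderiv 𝓘(ℝ, E) F x v) h
  have mUW : MDiffAt (fun y ↦ (inner ℝ (U y) (W y) : ℝ)) x := metricFun_mdifferentiableAt dU dW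
  rw [mvfderiv_sub mUW hs.1, hs.2, sub_apply, sum_apply,
    mvfderiv_inner_leviCivita (S.mdifferentiableAt_φ dU) (S.mdifferentiableAt_φ dW),
    mvfderiv_inner_leviCivita dU dW, S.leviCivita_φ dU, S.leviCivita_φ dW] at h1
  have h2 : ∀ i, mvfderiv 𝓘(ℝ, E) ((fun y ↦ (inner ℝ (U y) (S.ξ i y) : ℝ)) *
      fun y ↦ (inner ℝ (W y) (S.ξ i y) : ℝ)) x v =
      S.η i x u * S.η i x (leviCivita E M W x v)
      + S.η i x u * inner ℝ (leviCivita E M (S.ξ i) x v) w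
      + S.η i x w * S.η i x (leviCivita E M U x v)
      + S.η i x w * inner ℝ (leviCivita E M (S.ξ i) x v) u := by
    intro i
    rw [mvfderiv_mul (mU i) (mW i), add_apply, smul_apply, smul_apply,
      mvfderiv_inner_leviCivita dU (S.mdifferentiableAt_ξ i),
      mvfderiv_inner_leviCivita dW (S.mdifferentiableAt_ξ i), eU, eW]
    simp only [S.η_eq, smul_eq_mul, real_inner_comm u, real_inner_comm w]
    ring
  -- `inner_φ_φ` rewrites `g(φ ∇U, φ W)` and `g(φ U, φ ∇W)`, which removes all terms in `∇U` and
  -- `∇W` from the two sides.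
  simp only [h2, Finset.sum_add_distrib, eU, eW, inner_add_left, inner_add_right,
    S.inner_φ_φ] at h1
  rw [real_inner_comm (S.φ x u)]
  have h3 : ∑ i, S.η i x w * S.η i x (leviCivita E M U x v) =
      ∑ i, S.η i x (leviCivita E M U x v) * S.η i x w :=
    Finset.sum_congr rfl fun i _ ↦ mul_comm _ _
  linarith

end MetricFStructure

/-! ### The formula for `∇φ` on a generalized Kenmotsu manifold. -/

/-- The algebra behind the formula for `∇φ` on a normal metric `f`-manifold with closed `η^i`. -/
lemma two_mul_eq_cyclic_sub_cyclic {V : Type*} {t B : V → V → V → ℝ} {φ : V → V}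
    (ht : ∀ x y z, t x y z = -t x z y)
    (hN : ∀ x y z, t (φ x) y z - t (φ y) x z + t x y (φ z) - t y x (φ z) = 0)
    (hS : ∀ x y z, t x (φ y) z = t x y (φ z) + B z x y + B y x z)
    (hφ : ∀ x y z, t x y (φ (φ z)) = -t x y z - B z x (φ y))
    (hB : ∀ x y z, B (φ x) y z = 0) (hBs : ∀ x y z, B x y z = B x z y) (x y z : V) :
    2 * t x y z = t x y z + t y z x + t z x y
      - (t x (φ y) (φ z) + t (φ y) (φ z) x + t (φ z) x (φ y)) := by
  -- By hand: `hS`, `hφ` and `hB` turn `t x (φ y) (φ z)` into `-t x y z` plus `B`-terms. In the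
  -- other two terms of the second cyclic sum, `hS` moves `φ` onto `x`; `hN y z (φ x)` and `hφ` then
  -- turn them into `t y z x + t z x y` plus `B`-terms. All `B`-terms cancel by the symmetry `hBs`.
  grind

namespace MetricFStructure

variable {s : ℕ} {S : MetricFStructure E M s} {x : M}

/-- If `η^i` is closed, then `∇ξ_i` is symmetric. -/
lemma inner_leviCivita_ξ_comm {i : Fin s}
    (h : ∀ X Y : Π x : M, TangentSpace 𝓘(ℝ, E) x, MDiffAt (T% X) x → MDiffAt (T% Y) x →
      extDeriv₁ (S.η i) X Y x = 0) (u v : TangentSpace 𝓘(ℝ, E) x) :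
    (inner ℝ (leviCivita E M (S.ξ i) x u) v : ℝ) = inner ℝ (leviCivita E M (S.ξ i) x v) u := by
  set U := FiberBundle.extend E u with hU
  set W := FiberBundle.extend E v with hW
  have dU : MDiffAt (T% U) x := FiberBundle.mdifferentiableAt_extend 𝓘(ℝ, E) E u
  have dW : MDiffAt (T% W) x := FiberBundle.mdifferentiableAt_extend 𝓘(ℝ, E) E v
  have eU : U x = u := by simp [hU]
  have eW : W x = v := by simp [hW]
  have h1 := h U W dU dW
  simp only [extDeriv₁, S.η_eq] at h1
  rw [mvfderiv_inner_leviCivita dU (S.mdifferentiableAt_ξ i),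
    mvfderiv_inner_leviCivita dW (S.mdifferentiableAt_ξ i),
    mlieBracket_eq_leviCivita_sub dU dW, inner_sub_left, eU, eW] at h1
  rw [real_inner_comm v, real_inner_comm u]
  linarith

/-- Vanishing of the Nijenhuis tensor in terms of `∇φ`. -/
lemma nablaφ_of_nijenhuis_eq_zero
    (h : ∀ X Y : Π x : M, TangentSpace 𝓘(ℝ, E) x, MDiffAt (T% X) x → MDiffAt (T% Y) x →
      S.nijenhuis X Y x = 0) (u v : TangentSpace 𝓘(ℝ, E) x) :
    S.nablaφ x v (S.φ x u) - S.nablaφ x u (S.φ x v)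
      - S.φ x (S.nablaφ x v u) + S.φ x (S.nablaφ x u v) = 0 := by
  set U := FiberBundle.extend E u with hU
  set W := FiberBundle.extend E v with hW
  have dU : MDiffAt (T% U) x := FiberBundle.mdifferentiableAt_extend 𝓘(ℝ, E) E u
  have dW : MDiffAt (T% W) x := FiberBundle.mdifferentiableAt_extend 𝓘(ℝ, E) E v
  have eU : U x = u := by simp [hU]
  have eW : W x = v := by simp [hW]
  have h1 := h U W dU dW
  have dU' := S.mdifferentiableAt_φ dU
  have dW' := S.mdifferentiableAt_φ dW
  rw [nijenhuis, mlieBracket_eq_leviCivita_sub dU dW, mlieBracket_eq_leviCivita_sub dU' dW',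
    mlieBracket_eq_leviCivita_sub dU' dW, mlieBracket_eq_leviCivita_sub dU dW',
    S.leviCivita_φ dW, S.leviCivita_φ dU, S.leviCivita_φ dW, S.leviCivita_φ dU, eU, eW] at h1
  rw [← h1]
  simp only [map_sub, map_add]
  abel

/-- The exterior derivative of the fundamental form is the cyclic sum of `∇φ`. -/
lemma extDeriv₂_fundamentalForm {X Y Z : Π x : M, TangentSpace 𝓘(ℝ, E) x}
    (hX : MDiffAt (T% X) x) (hY : MDiffAt (T% Y) x) (hZ : MDiffAt (T% Z) x) :
    3 * extDeriv₂ S.fundamentalForm X Y Z x =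
      -(inner ℝ (S.nablaφ x (Y x) (X x)) (Z x) + inner ℝ (S.nablaφ x (Z x) (Y x)) (X x)
        + inner ℝ (S.nablaφ x (X x) (Z x)) (Y x)) := by
  simp only [extDeriv₂, fundamentalForm]
  rw [mvfderiv_inner_leviCivita hY (S.mdifferentiableAt_φ hZ),
    mvfderiv_inner_leviCivita hZ (S.mdifferentiableAt_φ hX),
    mvfderiv_inner_leviCivita hX (S.mdifferentiableAt_φ hY),
    mlieBracket_eq_leviCivita_sub hX hY, mlieBracket_eq_leviCivita_sub hY hZ,
    mlieBracket_eq_leviCivita_sub hZ hX, inner_sub_left, inner_sub_left, inner_sub_left,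
    S.leviCivita_φ hX, S.leviCivita_φ hY, S.leviCivita_φ hZ,
    S.inner_nablaφ_skew (X x), S.inner_nablaφ_skew (Y x), S.inner_nablaφ_skew (Z x)]
  simp only [inner_add_right, S.inner_φ]
  simp only [S.inner_φ_left, real_inner_comm (X x) (S.nablaφ x _ _),
    real_inner_comm (Y x) (S.nablaφ x _ _), real_inner_comm (Z x) (S.nablaφ x _ _),
    real_inner_comm (S.φ x _) (leviCivita E M _ x _)]
  ring

/-- On a generalized Kenmotsu manifold,
`(∇_v φ) u = ∑ i, (g(φ v, u) ξ_i - η^i(u) φ v)`. -/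
lemma IsGeneralizedKenmotsu.inner_nablaφ {n : ℕ} (hS : S.IsGeneralizedKenmotsu n)
    (v u w : TangentSpace 𝓘(ℝ, E) x) :
    (inner ℝ (S.nablaφ x u v) w : ℝ) =
      (∑ i, S.η i x w) * inner ℝ (S.φ x v) u - (∑ i, S.η i x u) * inner ℝ (S.φ x v) w := by
  have hN : ∀ X Y : Π x : M, TangentSpace 𝓘(ℝ, E) x, MDiffAt (T% X) x → MDiffAt (T% Y) x →
      S.nijenhuis X Y x = 0 := fun X Y hX hY ↦ by
    simpa [hS.closed _ x X Y hX hY] using hS.normal x X Y hX hY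
  -- The cyclic sum of `∇φ` is `-3 dΦ`, and the Kenmotsu condition makes it algebraic in `η` and
  -- `Φ`.
  have hcyc : ∀ u v w : TangentSpace 𝓘(ℝ, E) x,
      (inner ℝ (S.nablaφ x v u) w + inner ℝ (S.nablaφ x w v) u + inner ℝ (S.nablaφ x u w) v : ℝ) =
      -2 * ((∑ i, S.η i x u) * inner ℝ v (S.φ x w) + (∑ i, S.η i x v) * inner ℝ w (S.φ x u)
        + (∑ i, S.η i x w) * inner ℝ u (S.φ x v)) := by
    intro u v w
    have dU := FiberBundle.mdifferentiableAt_extend 𝓘(ℝ, E) E u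
    have dV := FiberBundle.mdifferentiableAt_extend 𝓘(ℝ, E) E v
    have dW := FiberBundle.mdifferentiableAt_extend 𝓘(ℝ, E) E w
    have h1 := extDeriv₂_fundamentalForm (S := S) dU dV dW
    rw [hS.extDeriv_fundamentalForm x _ _ _ dU dV dW] at h1
    simp only [wedge₁₂, fundamentalForm, FiberBundle.extend_apply_self, ← Finset.mul_sum,
      Finset.sum_add_distrib, ← Finset.sum_mul] at h1
    linarith
  have h2 := two_mul_eq_cyclic_sub_cyclic
    (t := fun v u w : TangentSpace 𝓘(ℝ, E) x ↦ (inner ℝ (S.nablaφ x u v) w : ℝ))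
    (B := fun u v w : TangentSpace 𝓘(ℝ, E) x ↦
      ∑ i, S.η i x u * (inner ℝ (leviCivita E M (S.ξ i) x v) w : ℝ)) (φ := S.φ x)
    (fun v u w ↦ S.inner_nablaφ_skew v u w)
    (fun u v w ↦ by
      have := congrArg (fun z ↦ (inner ℝ z w : ℝ)) (nablaφ_of_nijenhuis_eq_zero hN u v)
      simp only [inner_add_left, inner_sub_left, S.inner_φ_left, inner_zero_left] at this
      linarith)
    (fun v u w ↦ by
      have := S.inner_nablaφ_φ v u w
      rw [S.inner_nablaφ_skew v (S.φ x u) w]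
      linarith)
    (fun v u w ↦ by
      have h3 : ∀ i, (inner ℝ (S.nablaφ x u v) (S.ξ i x) : ℝ) =
          -inner ℝ (leviCivita E M (S.ξ i) x v) (S.φ x u) := fun i ↦ by
        rw [S.inner_nablaφ_skew, S.nablaφ_ξ, inner_neg_left, S.inner_φ_left, neg_neg]
      simp only [S.φ_φ, inner_add_right, inner_neg_right, inner_sum, real_inner_smul_right, h3,
        mul_neg, Finset.sum_neg_distrib]
      ring)
    (fun u v w ↦ by simp [S.η_φ])
    (fun u v w ↦ Finset.sum_congr rfl fun i _ ↦ by
      rw [inner_leviCivita_ξ_comm (hS.closed i x)])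
    v u w
  -- As `η ∘ φ = 0`, the cyclic sum at `(v, φ u, φ w)` retains only its `η(v)` term, which cancels
  -- the `η(v)` term of the sum at `(v, u, w)`.
  simp only [hcyc, S.η_φ, S.inner_φ_φ, Finset.sum_const_zero, zero_mul, add_zero, mul_zero,
    sub_zero] at h2
  rw [S.inner_φ x v u, real_inner_comm (S.φ x v) w] at h2
  linear_combination h2 / 2

end MetricFStructure

end KenmotsuTensor

/-! ### Vector fields along a map and the induced connection. -/

section Along

set_option linter.unusedSectionVars false

variable {E : Type*} [NormedAddCommGroup E] [NormedSpace ℝ E] [FiniteDimensional ℝ E]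
  {M : Type*} [TopologicalSpace M] [ChartedSpace E M] [IsManifold 𝓘(ℝ, E) ∞ M]
  {F : Type*} [NormedAddCommGroup F] [NormedSpace ℝ F] [FiniteDimensional ℝ F]
  {P : Type*} [TopologicalSpace P] [ChartedSpace F P] [IsManifold 𝓘(ℝ, F) ∞ P]

variable (E F) in
/-- Differentiability at `p` of a vector field `V` along `f`. -/
abbrev MDiffAlongAt (f : P → M) (V : Π p : P, TangentSpace 𝓘(ℝ, E) (f p)) (p : P) : Prop :=
  MDifferentiableAt 𝓘(ℝ, F) 𝓘(ℝ, E).tangent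
    (fun q ↦ (TotalSpace.mk' E (f q) (V q) : TangentBundle 𝓘(ℝ, E) M)) p

/-- Shows the extension as a constant-coefficient field in the trivialization at `x`, so that it is
linear in `v` over the base set. -/
lemma extend_eq_symmL {x y : M} (v : TangentSpace 𝓘(ℝ, E) x)
    (hy : y ∈ (trivializationAt E (TangentSpace 𝓘(ℝ, E) : M → Type _) x).baseSet) :
    FiberBundle.extend E v y =
      (trivializationAt E (TangentSpace 𝓘(ℝ, E) : M → Type _) x).symmL ℝ y
        ((trivializationAt E (TangentSpace 𝓘(ℝ, E) : M → Type _) x).continuousLinearMapAt ℝ x v) := by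
  have hx : x ∈ (trivializationAt E (TangentSpace 𝓘(ℝ, E) : M → Type _) x).baseSet :=
    FiberBundle.mem_baseSet_trivializationAt' x
  rw [Trivialization.continuousLinearMapAt_apply, Trivialization.linearMapAt_apply, if_pos hx,
    Trivialization.symmL_apply _ hy]
  rfl

/-- Coordinate vector fields commute. -/
lemma mlieBracket_extend {x : M} (v w : TangentSpace 𝓘(ℝ, E) x) :
    mlieBracket 𝓘(ℝ, E) (FiberBundle.extend E v : Π y : M, TangentSpace 𝓘(ℝ, E) y)
      (FiberBundle.extend E w) x = 0 := by
  -- The trivialization of `TM` at `x` is the differential of the chart, so in the chart the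
  -- extension is a constant field; constant fields have zero bracket.
  have key : ∀ u : TangentSpace 𝓘(ℝ, E) x, ∃ u₀ : E,
      mpullbackWithin 𝓘(ℝ, E) 𝓘(ℝ, E) (extChartAt 𝓘(ℝ, E) x).symm
        (FiberBundle.extend E u : Π y : M, TangentSpace 𝓘(ℝ, E) y) (Set.range 𝓘(ℝ, E))
        =ᶠ[nhds (extChartAt 𝓘(ℝ, E) x x)] fun _ ↦ u₀ := by
    intro u
    refine ⟨(trivializationAt E (TangentSpace 𝓘(ℝ, E) : M → Type _) x).continuousLinearMapAt
      ℝ x u, ?_⟩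
    filter_upwards [extChartAt_target_mem_nhds (I := 𝓘(ℝ, E)) x] with y hy
    have hy' : (extChartAt 𝓘(ℝ, E) x).symm y ∈ (chartAt E x).source := by
      have := (extChartAt 𝓘(ℝ, E) x).map_target hy
      rwa [extChartAt_source] at this
    rw [mpullbackWithin_apply, extend_eq_symmL u hy', TangentBundle.symmL_trivializationAt hy',
      (extChartAt 𝓘(ℝ, E) x).right_inv hy]
    exact congrFun (congrArg DFunLike.coe
      (isInvertible_mfderivWithin_extChartAt_symm hy).inverse_comp_self) _
  obtain ⟨v₀, hv⟩ := key v
  obtain ⟨w₀, hw⟩ := key w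
  have aux : ∀ {A B : E → E} {t : Set E} {z : E}, (A =ᶠ[nhds z] fun _ ↦ v₀) →
      (B =ᶠ[nhds z] fun _ ↦ w₀) → lieBracketWithin ℝ A B t z = 0 := fun hA hB ↦ by
    rw [hA.lieBracketWithin_vectorField_eq_nhds hB]
    simp [lieBracketWithin]
  rw [← mlieBracketWithin_univ, mlieBracketWithin_apply]
  exact (congrArg _ (aux hv hw)).trans (map_zero _)

lemma mdiffAlongAt_iff {f : P → M} {p : P} (hf : MDifferentiableAt 𝓘(ℝ, F) 𝓘(ℝ, E) f p)
    {V : Π p : P, TangentSpace 𝓘(ℝ, E) (f p)} :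
    MDiffAlongAt E F f V p ↔ MDifferentiableAt 𝓘(ℝ, F) 𝓘(ℝ, E)
      (fun q ↦ (trivializationAt E (TangentSpace 𝓘(ℝ, E) : M → Type _) (f p)
        (TotalSpace.mk' E (f q) (V q))).2) p := by
  rw [MDiffAlongAt, mdifferentiableAt_totalSpace]
  exact ⟨fun h ↦ h.2, fun h ↦ ⟨hf, h⟩⟩

variable {f : P → M} {p : P} {V W : Π p : P, TangentSpace 𝓘(ℝ, E) (f p)}

lemma eventually_mem_baseSet (hf : MDifferentiableAt 𝓘(ℝ, F) 𝓘(ℝ, E) f p) :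
    ∀ᶠ q in nhds p,
      f q ∈ (trivializationAt E (TangentSpace 𝓘(ℝ, E) : M → Type _) (f p)).baseSet :=
  hf.continuousAt.eventually_mem
    ((Trivialization.open_baseSet _).mem_nhds (FiberBundle.mem_baseSet_trivializationAt' _))

lemma coord_add (hf : MDifferentiableAt 𝓘(ℝ, F) 𝓘(ℝ, E) f p) :
    (fun q ↦ (trivializationAt E (TangentSpace 𝓘(ℝ, E) : M → Type _) (f p)
        (TotalSpace.mk' E (f q) (V q + W q))).2) =ᶠ[nhds p]
      (fun q ↦ (trivializationAt E (TangentSpace 𝓘(ℝ, E) : M → Type _) (f p)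
        (TotalSpace.mk' E (f q) (V q))).2) +
      fun q ↦ (trivializationAt E (TangentSpace 𝓘(ℝ, E) : M → Type _) (f p)
        (TotalSpace.mk' E (f q) (W q))).2 :=
  (eventually_mem_baseSet hf).mono fun q hq ↦ (Trivialization.linear ℝ _ hq).1 (V q) (W q)

lemma coord_smul (hf : MDifferentiableAt 𝓘(ℝ, F) 𝓘(ℝ, E) f p) (c : P → ℝ) :
    (fun q ↦ (trivializationAt E (TangentSpace 𝓘(ℝ, E) : M → Type _) (f p)
        (TotalSpace.mk' E (f q) (c q • V q))).2) =ᶠ[nhds p]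
      c • fun q ↦ (trivializationAt E (TangentSpace 𝓘(ℝ, E) : M → Type _) (f p)
        (TotalSpace.mk' E (f q) (V q))).2 :=
  (eventually_mem_baseSet hf).mono fun q hq ↦ (Trivialization.linear ℝ _ hq).2 (c q) (V q)

lemma MDiffAlongAt.add (hf : MDifferentiableAt 𝓘(ℝ, F) 𝓘(ℝ, E) f p)
    (hV : MDiffAlongAt E F f V p) (hW : MDiffAlongAt E F f W p) :
    MDiffAlongAt E F f (fun q ↦ V q + W q) p := by
  rw [mdiffAlongAt_iff hf] at hV hW ⊢
  exact (hV.add hW).congr_of_eventuallyEq (coord_add hf)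

lemma MDiffAlongAt.smul (hf : MDifferentiableAt 𝓘(ℝ, F) 𝓘(ℝ, E) f p) {c : P → ℝ}
    (hc : MDifferentiableAt 𝓘(ℝ, F) 𝓘(ℝ, ℝ) c p) (hV : MDiffAlongAt E F f V p) :
    MDiffAlongAt E F f (fun q ↦ c q • V q) p := by
  rw [mdiffAlongAt_iff hf] at hV ⊢
  exact (hc.smul hV).congr_of_eventuallyEq (coord_smul hf c)

lemma mdiffAlongAt_comp (hf : MDifferentiableAt 𝓘(ℝ, F) 𝓘(ℝ, E) f p)
    {Y : Π x : M, TangentSpace 𝓘(ℝ, E) x} (hY : MDiffAt (T% Y) (f p)) :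
    MDiffAlongAt E F f (fun q ↦ Y (f q)) p :=
  MDifferentiableAt.comp p hY hf

/-- A property of vector fields along `f` that depends only on the germ at `p`, is stable under sums
and products with functions, and holds for restrictions of vector fields on `M`, holds for all
vector fields along `f` that are differentiable at `p`. -/
theorem MDiffAlongAt.induction (hf : MDifferentiableAt 𝓘(ℝ, F) 𝓘(ℝ, E) f p)
    {motive : (Π p : P, TangentSpace 𝓘(ℝ, E) (f p)) → Prop}
    (congr : ∀ V W : Π p : P, TangentSpace 𝓘(ℝ, E) (f p), (∀ᶠ q in nhds p, W q = V q) →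
      motive V → motive W)
    (hadd : ∀ V W : Π p : P, TangentSpace 𝓘(ℝ, E) (f p), MDiffAlongAt E F f V p →
      MDiffAlongAt E F f W p → motive V → motive W → motive (fun q ↦ V q + W q))
    (smul : ∀ (c : P → ℝ) (V : Π p : P, TangentSpace 𝓘(ℝ, E) (f p)),
      MDifferentiableAt 𝓘(ℝ, F) 𝓘(ℝ, ℝ) c p → MDiffAlongAt E F f V p → motive V →
      motive (fun q ↦ c q • V q))
    (comp : ∀ Y : Π x : M, TangentSpace 𝓘(ℝ, E) x, MDiffAt (T% Y) (f p) →
      motive (fun q ↦ Y (f q)))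
    {V : Π p : P, TangentSpace 𝓘(ℝ, E) (f p)} (hV : MDiffAlongAt E F f V p) : motive V := by
  classical
  set e := trivializationAt E (TangentSpace 𝓘(ℝ, E) : M → Type _) (f p) with he
  have hp : f p ∈ e.baseSet := FiberBundle.mem_baseSet_trivializationAt' (f p)
  let b := Module.finBasis ℝ E
  -- Near `p`, `V = ∑ c i • (Y i ∘ f)`, with `Y i` the frame that is constant in the trivialization
  -- at `f p`.
  let c : Fin (finrank ℝ E) → P → ℝ := fun i q ↦ b.repr (e (TotalSpace.mk' E (f q) (V q))).2 i
  let Y : Fin (finrank ℝ E) → Π x : M, TangentSpace 𝓘(ℝ, E) x := fun i ↦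
    FiberBundle.extend E (e.symmL ℝ (f p) (b i))
  have hY : ∀ i, MDiffAt (T% (Y i)) (f p) := fun i ↦
    FiberBundle.mdifferentiableAt_extend 𝓘(ℝ, E) E _
  have hYe : ∀ i, ∀ y ∈ e.baseSet, Y i y = e.symmL ℝ y (b i) := fun i y hy ↦ by
    simp only [Y]
    rw [extend_eq_symmL _ hy]
    exact congrArg _ (e.continuousLinearMapAt_symmL hp _)
  have hc : ∀ i, MDifferentiableAt 𝓘(ℝ, F) 𝓘(ℝ, ℝ) (c i) p := fun i ↦ by
    have h1 := (mdiffAlongAt_iff hf).1 hV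
    let L : E →L[ℝ] ℝ := LinearMap.toContinuousLinearMap (b.coord i)
    exact L.mdifferentiableAt.comp p h1
  -- Differentiability of the partial sums is carried along because `hadd` requires it.
  have main : ∀ t : Finset (Fin (finrank ℝ E)),
      MDiffAlongAt E F f (fun q ↦ ∑ i ∈ t, c i q • Y i (f q)) p ∧
        motive (fun q ↦ ∑ i ∈ t, c i q • Y i (f q)) := by
    intro t
    induction t using Finset.induction_on with
    | empty =>
      have h0 : MDiffAt (T% (0 : Π x : M, TangentSpace 𝓘(ℝ, E) x)) (f p) :=
        mdifferentiable_zeroSection _ _ (f p)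
      simp only [Finset.sum_empty]
      exact ⟨mdiffAlongAt_comp hf h0, comp 0 h0⟩
    | insert a t ha ih =>
      simp only [Finset.sum_insert ha]
      have h1 := MDiffAlongAt.smul hf (hc a) (mdiffAlongAt_comp hf (hY a))
      exact ⟨MDiffAlongAt.add hf h1 ih.1, hadd _ _ h1 ih.1
        (smul _ _ (hc a) (mdiffAlongAt_comp hf (hY a)) (comp _ (hY a))) ih.2⟩
  refine congr _ _ ?_ (main Finset.univ).2
  filter_upwards [eventually_mem_baseSet hf] with q hq
  simp only [hYe _ _ hq, ← map_smul, ← map_sum]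
  rw [b.sum_repr]
  exact ((e.symmL_apply hq _).trans (e.symm_apply_apply_mk hq (V q))).symm

variable
  [RiemannianBundle (fun x : M ↦ TangentSpace 𝓘(ℝ, E) x)]
  [IsContMDiffRiemannianBundle 𝓘(ℝ, E) ∞ E (fun x : M ↦ TangentSpace 𝓘(ℝ, E) x)]

lemma mvfderiv_congr {E' : Type*} [NormedAddCommGroup E'] [NormedSpace ℝ E'] {g g' : P → E'}
    (h : g =ᶠ[nhds p] g') : mvfderiv 𝓘(ℝ, F) g p = mvfderiv 𝓘(ℝ, F) g' p := by
  ext v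
  simp only [mvfderiv, ContinuousLinearMap.comp_apply]
  rw [h.mfderiv_eq]
  rfl

lemma leviCivita_congr {Y Y' : Π x : M, TangentSpace 𝓘(ℝ, E) x} {x : M}
    (hY : MDiffAt (T% Y) x) (hY' : MDiffAt (T% Y') x) (h : Y =ᶠ[nhds x] Y') :
    leviCivita E M Y x = leviCivita E M Y' x :=
  (leviCivita E M).isCovariantDerivativeOnUniv.congr_of_eventuallyEq hY hY'
    Filter.univ_mem h

/-- The two fields agree only over the base set of the trivialization, so locality of the connection
is needed. This gives additivity of the Christoffel part of `covAlong`. -/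
lemma leviCivita_extend_add {x : M} (v w : TangentSpace 𝓘(ℝ, E) x) :
    leviCivita E M (FiberBundle.extend E (v + w)) x =
      leviCivita E M (FiberBundle.extend E v) x + leviCivita E M (FiberBundle.extend E w) x := by
  rw [← (leviCivita E M).isCovariantDerivativeOnUniv.add
      (FiberBundle.mdifferentiableAt_extend 𝓘(ℝ, E) E _)
      (FiberBundle.mdifferentiableAt_extend 𝓘(ℝ, E) E _)]
  refine leviCivita_congr (FiberBundle.mdifferentiableAt_extend 𝓘(ℝ, E) E _)
    (mdifferentiableAt_add_section (FiberBundle.mdifferentiableAt_extend 𝓘(ℝ, E) E _)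
      (FiberBundle.mdifferentiableAt_extend 𝓘(ℝ, E) E _)) ?_
  filter_upwards [(trivializationAt E (TangentSpace 𝓘(ℝ, E) : M → Type _) x).open_baseSet.mem_nhds
    (FiberBundle.mem_baseSet_trivializationAt' x)] with y hy
  rw [Pi.add_apply, extend_eq_symmL _ hy, extend_eq_symmL _ hy, extend_eq_symmL _ hy, map_add,
    map_add]

lemma leviCivita_extend_smul {x : M} (c : ℝ) (v : TangentSpace 𝓘(ℝ, E) x) :
    leviCivita E M (FiberBundle.extend E (c • v)) x =
      c • leviCivita E M (FiberBundle.extend E v) x := by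
  rw [← (leviCivita E M).isCovariantDerivativeOnUniv.smul_const c
      (FiberBundle.mdifferentiableAt_extend 𝓘(ℝ, E) E _)]
  refine leviCivita_congr (FiberBundle.mdifferentiableAt_extend 𝓘(ℝ, E) E _)
    (MDifferentiableAt.smul_const_section (FiberBundle.mdifferentiableAt_extend 𝓘(ℝ, E) E _)) ?_
  filter_upwards [(trivializationAt E (TangentSpace 𝓘(ℝ, E) : M → Type _) x).open_baseSet.mem_nhds
    (FiberBundle.mem_baseSet_trivializationAt' x)] with y hy
  rw [Pi.smul_apply, extend_eq_symmL _ hy, extend_eq_symmL _ hy, map_smul, map_smul]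

lemma MDiffAlongAt.inner (hV : MDiffAlongAt E F f V p) (hW : MDiffAlongAt E F f W p) :
    MDifferentiableAt 𝓘(ℝ, F) 𝓘(ℝ, ℝ) (fun q ↦ (inner ℝ (V q) (W q) : ℝ)) p :=
  MDifferentiableAt.inner_bundle hV hW

lemma covAlong_congr (h : ∀ᶠ q in nhds p, V q = W q) :
    covAlong E F f V p = covAlong E F f W p := by
  rw [covAlong, covAlong, h.self_of_nhds]
  congr 2
  exact mvfderiv_congr (h.mono fun q hq ↦ by simp only [hq])

lemma covAlong_add (hf : MDifferentiableAt 𝓘(ℝ, F) 𝓘(ℝ, E) f p)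
    (hV : MDiffAlongAt E F f V p) (hW : MDiffAlongAt E F f W p) :
    covAlong E F f (fun q ↦ V q + W q) p = covAlong E F f V p + covAlong E F f W p := by
  rw [mdiffAlongAt_iff hf] at hV hW
  simp only [covAlong]
  rw [mvfderiv_congr (coord_add hf), mvfderiv_add hV hW, leviCivita_extend_add,
    ContinuousLinearMap.comp_add, ContinuousLinearMap.add_comp]
  abel

/-- The derivative of `c` enters only through the coordinate part of `covAlong`; the Christoffel
part is linear in the value at `p`. -/
lemma covAlong_smul (hf : MDifferentiableAt 𝓘(ℝ, F) 𝓘(ℝ, E) f p) {c : P → ℝ}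
    (hc : MDifferentiableAt 𝓘(ℝ, F) 𝓘(ℝ, ℝ) c p) (hV : MDiffAlongAt E F f V p)
    (u : TangentSpace 𝓘(ℝ, F) p) :
    covAlong E F f (fun q ↦ c q • V q) p u =
      c p • covAlong E F f V p u + mvfderiv 𝓘(ℝ, F) c p u • V p := by
  have hp : f p ∈ (trivializationAt E (TangentSpace 𝓘(ℝ, E) : M → Type _) (f p)).baseSet :=
    FiberBundle.mem_baseSet_trivializationAt' (f p)
  rw [mdiffAlongAt_iff hf] at hV
  simp only [covAlong]
  rw [mvfderiv_congr (coord_smul hf c), mvfderiv_smul hc hV, leviCivita_extend_smul]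
  have h2 := (Trivialization.symmL_apply (R := ℝ) _ hp _).trans
    (Trivialization.symm_apply_apply_mk _ hp (V p))
  simp [h2]
  abel

/-- The induced connection along `f` is compatible with the metric. -/
theorem mvfderiv_inner_covAlong (hf : MDifferentiableAt 𝓘(ℝ, F) 𝓘(ℝ, E) f p)
    (hV : MDiffAlongAt E F f V p) (hW : MDiffAlongAt E F f W p) (u : TangentSpace 𝓘(ℝ, F) p) :
    mvfderiv 𝓘(ℝ, F) (fun q ↦ (inner ℝ (V q) (W q) : ℝ)) p u =
      inner ℝ (covAlong E F f V p u) (W p) + inner ℝ (V p) (covAlong E F f W p u) := by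
  -- Induction on the second field alone. It is used twice, with the two slots exchanged by symmetry
  -- of the metric, which leaves the case where both fields come from `M`.
  have step : ∀ V : Π p : P, TangentSpace 𝓘(ℝ, E) (f p), MDiffAlongAt E F f V p →
      (∀ Y : Π x : M, TangentSpace 𝓘(ℝ, E) x, MDiffAt (T% Y) (f p) →
        mvfderiv 𝓘(ℝ, F) (fun q ↦ (inner ℝ (V q) (Y (f q)) : ℝ)) p u =
          inner ℝ (covAlong E F f V p u) (Y (f p)) +
            inner ℝ (V p) (covAlong E F f (fun q ↦ Y (f q)) p u)) →
      ∀ W : Π p : P, TangentSpace 𝓘(ℝ, E) (f p), MDiffAlongAt E F f W p →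
        mvfderiv 𝓘(ℝ, F) (fun q ↦ (inner ℝ (V q) (W q) : ℝ)) p u =
          inner ℝ (covAlong E F f V p u) (W p) + inner ℝ (V p) (covAlong E F f W p u) := by
    intro V hV hY W hW
    refine MDiffAlongAt.induction hf (motive := fun W ↦
      mvfderiv 𝓘(ℝ, F) (fun q ↦ (inner ℝ (V q) (W q) : ℝ)) p u =
          inner ℝ (covAlong E F f V p u) (W p) + inner ℝ (V p) (covAlong E F f W p u))
      ?_ ?_ ?_ hY hW
    · intro W W' h hW
      rw [covAlong_congr h, h.self_of_nhds, ← hW]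
      exact DFunLike.congr_fun (mvfderiv_congr (h.mono fun q hq ↦ by simp only [hq])) u
    · intro W W' dW dW' hW hW'
      have h1 : (fun q ↦ (inner ℝ (V q) (W q + W' q) : ℝ)) =
          (fun q ↦ (inner ℝ (V q) (W q) : ℝ)) + fun q ↦ (inner ℝ (V q) (W' q) : ℝ) := by
        funext q; exact inner_add_right _ _ _
      rw [h1, mvfderiv_add (hV.inner dW) (hV.inner dW'), add_apply, hW, hW',
        covAlong_add hf dW dW', add_apply, inner_add_right, inner_add_right]
      ring
    · intro c W hc dW hW
      have h1 : (fun q ↦ (inner ℝ (V q) (c q • W q) : ℝ)) =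
          c * fun q ↦ (inner ℝ (V q) (W q) : ℝ) := by
        funext q; exact real_inner_smul_right _ _ _
      rw [h1, mvfderiv_mul hc (hV.inner dW), covAlong_smul hf hc dW, add_apply, smul_apply,
        smul_apply, hW, inner_add_right, real_inner_smul_right, real_inner_smul_right,
        real_inner_smul_right, smul_eq_mul, smul_eq_mul]
      ring
  refine step V hV (fun Y hY ↦ ?_) W hW
  have h1 := step (fun q ↦ Y (f q)) (mdiffAlongAt_comp hf hY) (fun Z hZ ↦ ?_) V hV
  · rw [real_inner_comm, real_inner_comm _ (V p), add_comm, ← h1]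
    simp only [real_inner_comm]
  · rw [covAlong_comp f Y p hf hY, covAlong_comp f Z p hf hZ]
    have h2 := mvfderiv_comp_apply p (metricFun_mdifferentiableAt hY hZ) hf u
    exact h2.trans (mvfderiv_inner_leviCivita hY hZ _)

/-- `∇_u (φ V) = φ (∇_u V) + (∇_{df u} φ) V` along `f`. -/
theorem MetricFStructure.covAlong_φ {s : ℕ} (S : MetricFStructure E M s)
    (hf : MDifferentiableAt 𝓘(ℝ, F) 𝓘(ℝ, E) f p) (hV : MDiffAlongAt E F f V p)
    (u : TangentSpace 𝓘(ℝ, F) p) :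
    covAlong E F f (fun q ↦ S.φ (f q) (V q)) p u =
      S.φ (f p) (covAlong E F f V p u)
        + S.nablaφ (f p) (V p) (mfderiv 𝓘(ℝ, F) 𝓘(ℝ, E) f p u) := by
  have hφ : ∀ {V : Π p : P, TangentSpace 𝓘(ℝ, E) (f p)}, MDiffAlongAt E F f V p →
      MDiffAlongAt E F f (fun q ↦ S.φ (f q) (V q)) p := fun hV ↦
    (((S.smooth_φ (f p)).mdifferentiableAt (by simp)).comp p hf).clm_bundle_apply hV
  refine MDiffAlongAt.induction hf (motive := fun V ↦
    covAlong E F f (fun q ↦ S.φ (f q) (V q)) p u = S.φ (f p) (covAlong E F f V p u)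
      + S.nablaφ (f p) (V p) (mfderiv 𝓘(ℝ, F) 𝓘(ℝ, E) f p u)) ?_ ?_ ?_ ?_ hV
  · intro V W h hV
    rw [covAlong_congr h, h.self_of_nhds, ← hV]
    exact DFunLike.congr_fun (covAlong_congr (h.mono fun q hq ↦ by simp only [hq])) u
  · intro V W dV dW hV hW
    simp only [map_add]
    rw [covAlong_add hf (hφ dV) (hφ dW), covAlong_add hf dV dW, add_apply, add_apply, hV, hW,
      map_add, add_apply]
    abel
  · intro c V hc dV hV
    simp only [map_smul]
    rw [covAlong_smul hf hc (hφ dV), covAlong_smul hf hc dV, hV]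
    simp only [map_add, map_smul, smul_add, smul_apply]
    abel
  · intro Y hY
    rw [covAlong_comp f Y p hf hY,
      covAlong_comp f (fun y ↦ S.φ y (Y y)) p hf (S.mdifferentiableAt_φ hY)]
    simp only [ContinuousLinearMap.comp_apply]
    rw [S.leviCivita_φ hY, add_comm]

end Along

/-! ### Symmetry of the second fundamental form. -/

section Symmetry

set_option linter.unusedSectionVars false

variable {E : Type*} [NormedAddCommGroup E] [NormedSpace ℝ E] [FiniteDimensional ℝ E]
  {M : Type*} [TopologicalSpace M] [ChartedSpace E M] [IsManifold 𝓘(ℝ, E) ∞ M]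
  {F : Type*} [NormedAddCommGroup F] [NormedSpace ℝ F] [FiniteDimensional ℝ F]
  {P : Type*} [TopologicalSpace P] [ChartedSpace F P] [IsManifold 𝓘(ℝ, F) ∞ P]
  {f : P → M}

variable (E) in
/-- The vector field along `f` that is the image under `df` of the coordinate vector field with
value `v` at `p`. -/
def pushExtend (f : P → M) {p : P} (v : TangentSpace 𝓘(ℝ, F) p) (q : P) :
    TangentSpace 𝓘(ℝ, E) (f q) :=
  mfderiv 𝓘(ℝ, F) 𝓘(ℝ, E) f q (FiberBundle.extend F v q)

/-- The chain rule for `f` read in charts, with `g` in the role of an inverse chart; `hq` keeps the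
base point `q` free of the expression `g z`. -/
lemma fderiv_comp_comp_apply {φ : M → E} {g : F → P} {z : F} {q : P} (hq : g z = q)
    (hφ : MDifferentiableAt 𝓘(ℝ, E) 𝓘(ℝ, E) φ (f q)) (hf : MDifferentiableAt 𝓘(ℝ, F) 𝓘(ℝ, E) f q)
    (hg : MDifferentiableAt 𝓘(ℝ, F) 𝓘(ℝ, F) g z) (a : F) :
    fderiv ℝ (φ ∘ f ∘ g) z a = mfderiv 𝓘(ℝ, E) 𝓘(ℝ, E) φ (f q) (mfderiv 𝓘(ℝ, F) 𝓘(ℝ, E) f q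
      (mfderivWithin 𝓘(ℝ, F) 𝓘(ℝ, F) g (Set.range 𝓘(ℝ, F)) z a)) := by
  subst hq
  rw [← mfderiv_eq_fderiv, ModelWithCorners.range_eq_univ, mfderivWithin_univ]
  exact (mfderiv_comp_apply z hφ (hf.comp z hg) a).trans
    (congrArg _ (mfderiv_comp_apply z hf hg a))

/-- In coordinates, `pushExtend` is a directional derivative of the map `f`. -/
lemma coord_pushExtend (hf : ContMDiff 𝓘(ℝ, F) 𝓘(ℝ, E) ∞ f) {p : P} (v : TangentSpace 𝓘(ℝ, F) p) :
    (fun q ↦ (trivializationAt E (TangentSpace 𝓘(ℝ, E) : M → Type _) (f p)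
      (TotalSpace.mk' E (f q) (pushExtend E f v q))).2) =ᶠ[nhds p]
    fun q ↦ fderiv ℝ (writtenInExtChartAt 𝓘(ℝ, F) 𝓘(ℝ, E) p f) (extChartAt 𝓘(ℝ, F) p q)
      (mfderiv 𝓘(ℝ, F) 𝓘(ℝ, F) (extChartAt 𝓘(ℝ, F) p) p v) := by
  have hdf : MDifferentiable 𝓘(ℝ, F) 𝓘(ℝ, E) f := hf.mdifferentiable (by simp)
  filter_upwards [eventually_mem_baseSet (hdf p), (chartAt F p).open_source.mem_nhds
    (mem_chart_source F p)] with q hq hqp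
  have hq' : f q ∈ (chartAt E (f p)).source := by
    rwa [TangentBundle.trivializationAt_baseSet] at hq
  have hqP : q ∈ (trivializationAt F (TangentSpace 𝓘(ℝ, F) : P → Type _) p).baseSet := by
    rwa [TangentBundle.trivializationAt_baseSet]
  have hqs : q ∈ (extChartAt 𝓘(ℝ, F) p).source := by rwa [extChartAt_source]
  have hqt := (extChartAt 𝓘(ℝ, F) p).map_source hqs
  -- Trivialization coordinates are values of the chart differential, so the chain rule applies to
  -- chart ∘ `f` ∘ inverse chart.
  have h1 : ∀ w : TangentSpace 𝓘(ℝ, E) (f q),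
      (trivializationAt E (TangentSpace 𝓘(ℝ, E) : M → Type _) (f p)
        (TotalSpace.mk' E (f q) w)).2 =
      mfderiv 𝓘(ℝ, E) 𝓘(ℝ, E) (extChartAt 𝓘(ℝ, E) (f p)) (f q) w := fun w ↦ by
    refine Eq.trans ?_ (DFunLike.congr_fun
      (TangentBundle.continuousLinearMapAt_trivializationAt (I := 𝓘(ℝ, E)) hq') w)
    exact ((congrFun (Trivialization.coe_linearMapAt_of_mem (R := ℝ) _ hq) w)).symm
  rw [h1, pushExtend, extend_eq_symmL v hqP, TangentBundle.symmL_trivializationAt hqp,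
    TangentBundle.continuousLinearMapAt_trivializationAt (mem_chart_source F p)]
  have d1 : MDifferentiableAt 𝓘(ℝ, F) 𝓘(ℝ, F) (extChartAt 𝓘(ℝ, F) p).symm
      (extChartAt 𝓘(ℝ, F) p q) := by
    have := mdifferentiableWithinAt_extChartAt_symm hqt
    rwa [ModelWithCorners.range_eq_univ, mdifferentiableWithinAt_univ] at this
  exact (fderiv_comp_comp_apply ((extChartAt 𝓘(ℝ, F) p).left_inv hqs)
    (mdifferentiableAt_extChartAt hq') (hdf q) d1 _).symm

lemma contDiffAt_writtenInExtChartAt (hf : ContMDiff 𝓘(ℝ, F) 𝓘(ℝ, E) ∞ f) (p : P) :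
    ContDiffAt ℝ ∞ (writtenInExtChartAt 𝓘(ℝ, F) 𝓘(ℝ, E) p f) (extChartAt 𝓘(ℝ, F) p p) := by
  have := (contMDiffAt_iff.1 (hf p)).2
  rwa [ModelWithCorners.range_eq_univ, contDiffWithinAt_univ] at this

/-- Exhibits the coordinate part of `∇_u (df V)` as a second derivative of `f` in charts, to which
Schwarz's theorem applies. -/
lemma mvfderiv_coord_pushExtend (hf : ContMDiff 𝓘(ℝ, F) 𝓘(ℝ, E) ∞ f) {p : P}
    (v : TangentSpace 𝓘(ℝ, F) p) :
    MDifferentiableAt 𝓘(ℝ, F) 𝓘(ℝ, E)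
      (fun q ↦ fderiv ℝ (writtenInExtChartAt 𝓘(ℝ, F) 𝓘(ℝ, E) p f) (extChartAt 𝓘(ℝ, F) p q)
        (mfderiv 𝓘(ℝ, F) 𝓘(ℝ, F) (extChartAt 𝓘(ℝ, F) p) p v)) p ∧
    ∀ u : TangentSpace 𝓘(ℝ, F) p, mvfderiv 𝓘(ℝ, F)
      (fun q ↦ fderiv ℝ (writtenInExtChartAt 𝓘(ℝ, F) 𝓘(ℝ, E) p f) (extChartAt 𝓘(ℝ, F) p q)
        (mfderiv 𝓘(ℝ, F) 𝓘(ℝ, F) (extChartAt 𝓘(ℝ, F) p) p v)) p u =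
      fderiv ℝ (fderiv ℝ (writtenInExtChartAt 𝓘(ℝ, F) 𝓘(ℝ, E) p f)) (extChartAt 𝓘(ℝ, F) p p)
        (mfderiv 𝓘(ℝ, F) 𝓘(ℝ, F) (extChartAt 𝓘(ℝ, F) p) p u)
        (mfderiv 𝓘(ℝ, F) 𝓘(ℝ, F) (extChartAt 𝓘(ℝ, F) p) p v) := by
  have h1 : DifferentiableAt ℝ (fderiv ℝ (writtenInExtChartAt 𝓘(ℝ, F) 𝓘(ℝ, E) p f))
      (extChartAt 𝓘(ℝ, F) p p) :=
    ((contDiffAt_writtenInExtChartAt hf p).fderiv_right (m := 1) (by norm_cast)).differentiableAt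
      (by simp)
  have key : ∀ v₀ : F, MDifferentiableAt 𝓘(ℝ, F) 𝓘(ℝ, E)
      (fun q ↦ fderiv ℝ (writtenInExtChartAt 𝓘(ℝ, F) 𝓘(ℝ, E) p f) (extChartAt 𝓘(ℝ, F) p q) v₀) p ∧
      ∀ u : TangentSpace 𝓘(ℝ, F) p, mvfderiv 𝓘(ℝ, F)
      (fun q ↦ fderiv ℝ (writtenInExtChartAt 𝓘(ℝ, F) 𝓘(ℝ, E) p f) (extChartAt 𝓘(ℝ, F) p q) v₀) p u =
      fderiv ℝ (fderiv ℝ (writtenInExtChartAt 𝓘(ℝ, F) 𝓘(ℝ, E) p f)) (extChartAt 𝓘(ℝ, F) p p)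
        (mfderiv 𝓘(ℝ, F) 𝓘(ℝ, F) (extChartAt 𝓘(ℝ, F) p) p u) v₀ := by
    intro v₀
    let G : F → E := fun z ↦ fderiv ℝ (writtenInExtChartAt 𝓘(ℝ, F) 𝓘(ℝ, E) p f) z v₀
    have hG : HasFDerivAt G ((fderiv ℝ (fderiv ℝ (writtenInExtChartAt 𝓘(ℝ, F) 𝓘(ℝ, E) p f))
        (extChartAt 𝓘(ℝ, F) p p)).flip v₀) (extChartAt 𝓘(ℝ, F) p p) := by
      simpa only [ContinuousLinearMap.comp_zero, zero_add] using
        h1.hasFDerivAt.clm_apply (hasFDerivAt_const v₀ _)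
    have dx : MDifferentiableAt 𝓘(ℝ, F) 𝓘(ℝ, F) (extChartAt 𝓘(ℝ, F) p) p :=
      mdifferentiableAt_extChartAt (mem_chart_source F p)
    refine ⟨hG.differentiableAt.mdifferentiableAt.comp p dx, fun u ↦ ?_⟩
    have h2 := mfderiv_comp_apply p hG.differentiableAt.mdifferentiableAt dx u
    rw [mfderiv_eq_fderiv, hG.fderiv] at h2
    exact h2
  exact key _

lemma mdiffAlongAt_pushExtend (hf : ContMDiff 𝓘(ℝ, F) 𝓘(ℝ, E) ∞ f) {p : P}
    (v : TangentSpace 𝓘(ℝ, F) p) : MDiffAlongAt E F f (pushExtend E f v) p := by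
  rw [mdiffAlongAt_iff (hf.mdifferentiable (by simp) p)]
  exact (mvfderiv_coord_pushExtend hf v).1.congr_of_eventuallyEq (coord_pushExtend hf v)

@[simp] lemma pushExtend_self {p : P} (v : TangentSpace 𝓘(ℝ, F) p) :
    pushExtend E f v p = mfderiv 𝓘(ℝ, F) 𝓘(ℝ, E) f p v := by
  simp [pushExtend]

variable
  [RiemannianBundle (fun x : M ↦ TangentSpace 𝓘(ℝ, E) x)]
  [IsContMDiffRiemannianBundle 𝓘(ℝ, E) ∞ E (fun x : M ↦ TangentSpace 𝓘(ℝ, E) x)]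

/-- The second fundamental form is symmetric: `∇_u (df V) = ∇_v (df U)` for coordinate vector
fields `U` and `V`. -/
theorem covAlong_pushExtend_comm (hf : ContMDiff 𝓘(ℝ, F) 𝓘(ℝ, E) ∞ f) {p : P}
    (u v : TangentSpace 𝓘(ℝ, F) p) :
    covAlong E F f (pushExtend E f v) p u = covAlong E F f (pushExtend E f u) p v := by
  have hsymm : IsSymmSndFDerivAt ℝ (writtenInExtChartAt 𝓘(ℝ, F) 𝓘(ℝ, E) p f)
      (extChartAt 𝓘(ℝ, F) p p) :=
    (contDiffAt_writtenInExtChartAt hf p).isSymmSndFDerivAt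
      (by rw [minSmoothness_of_isRCLikeNormedField]; exact WithTop.coe_le_coe.2 le_top)
  -- Coordinate fields commute and the torsion is zero, so the Christoffel part is symmetric;
  -- `hsymm` handles the second-derivative part.
  have hb := mlieBracket_eq_leviCivita_sub
    (FiberBundle.mdifferentiableAt_extend 𝓘(ℝ, E) E (mfderiv 𝓘(ℝ, F) 𝓘(ℝ, E) f p u))
    (FiberBundle.mdifferentiableAt_extend 𝓘(ℝ, E) E (mfderiv 𝓘(ℝ, F) 𝓘(ℝ, E) f p v))
  rw [mlieBracket_extend, FiberBundle.extend_apply_self, FiberBundle.extend_apply_self] at hb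
  simp only [covAlong, add_apply, ContinuousLinearMap.comp_apply, pushExtend_self]
  rw [mvfderiv_congr (coord_pushExtend hf v), mvfderiv_congr (coord_pushExtend hf u),
    (mvfderiv_coord_pushExtend hf v).2, (mvfderiv_coord_pushExtend hf u).2]
  exact congrArg₂ (· + ·) (congrArg _ (hsymm.eq _ _)) (sub_eq_zero.1 hb.symm)

/-- For a normal field `N`, `g(∇_u N, df v) = g(∇_v N, df u)`. -/
theorem NormalField.inner_covAlong_comm (hf : ContMDiff 𝓘(ℝ, F) 𝓘(ℝ, E) ∞ f)
    (N : NormalField E F f) {p : P} (u v : TangentSpace 𝓘(ℝ, F) p) :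
    (inner ℝ (covAlong E F f N.toFun p u) (mfderiv 𝓘(ℝ, F) 𝓘(ℝ, E) f p v) : ℝ) =
      inner ℝ (covAlong E F f N.toFun p v) (mfderiv 𝓘(ℝ, F) 𝓘(ℝ, E) f p u) := by
  -- Differentiating `g(N, df V) = 0` moves the derivative from `N` to `df V`, where the symmetry is
  -- known.
  have key : ∀ u v : TangentSpace 𝓘(ℝ, F) p,
      (inner ℝ (covAlong E F f N.toFun p u) (mfderiv 𝓘(ℝ, F) 𝓘(ℝ, E) f p v) : ℝ) =
      -inner ℝ (N.toFun p) (covAlong E F f (pushExtend E f v) p u) := fun u v ↦ by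
    have h := mvfderiv_inner_covAlong (hf.mdifferentiable (by simp) p)
      ((N.smooth p).mdifferentiableAt (by simp)) (mdiffAlongAt_pushExtend hf v) u
    have h0 : (fun q ↦ (inner ℝ (N.toFun q) (pushExtend E f v q) : ℝ)) = 0 := by
      funext q; exact N.normal q _
    rw [h0, mvfderiv_zero, pushExtend_self] at h
    rw [zero_apply] at h
    linarith
  rw [key, key, covAlong_pushExtend_comm hf]

/-! ### The shape operator of an invariant submanifold. -/

variable {s n : ℕ} {S : MetricFStructure E M s} {p : P}

lemma inner_mfderiv_shapeOperator (hf : IsImmersedSubmanifold E F f) (N : NormalField E F f)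
    (u v : TangentSpace 𝓘(ℝ, F) p) :
    (inner ℝ (mfderiv 𝓘(ℝ, F) 𝓘(ℝ, E) f p (shapeOperator hf N p u))
      (mfderiv 𝓘(ℝ, F) 𝓘(ℝ, E) f p v) : ℝ) =
      -inner ℝ (covAlong E F f N.toFun p u) (mfderiv 𝓘(ℝ, F) 𝓘(ℝ, E) f p v) := by
  rw [← hf.inner_tangentialPart p (covAlong E F f N.toFun p u),
    show shapeOperator hf N p u = -hf.tangentialPart p (covAlong E F f N.toFun p u) from rfl,
    map_neg, inner_neg_left]

/-- The metric pulled back by the injective `df` is positive definite, so it separates vectors of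
`T_p P`. -/
lemma IsImmersedSubmanifold.ext_inner (hf : IsImmersedSubmanifold E F f)
    {u v : TangentSpace 𝓘(ℝ, F) p}
    (h : ∀ w, (inner ℝ (mfderiv 𝓘(ℝ, F) 𝓘(ℝ, E) f p u) (mfderiv 𝓘(ℝ, F) 𝓘(ℝ, E) f p w) : ℝ) =
      inner ℝ (mfderiv 𝓘(ℝ, F) 𝓘(ℝ, E) f p v) (mfderiv 𝓘(ℝ, F) 𝓘(ℝ, E) f p w)) : u = v := by
  refine hf.injective p (sub_eq_zero.1 ?_)
  have h1 := h (u - v)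
  rw [← inner_self_eq_zero (𝕜 := ℝ), ← map_sub]
  conv_lhs => arg 2; rw [map_sub]
  rw [inner_sub_left, h1, sub_self]

/-- `A_{φ N} = φ A_N`. -/
lemma shapeOperator_φNormal (hS : S.IsGeneralizedKenmotsu n)
    (hf : IsInvariantSubmanifold (F := F) S f) (N : NormalField E F f)
    (u : TangentSpace 𝓘(ℝ, F) p) :
    hf.φ p (shapeOperator hf.toIsImmersedSubmanifold N p u) =
      shapeOperator hf.toIsImmersedSubmanifold (hf.φNormal N) p u := by
  refine hf.ext_inner fun w ↦ ?_
  have h := S.covAlong_φ (hf.smooth.mdifferentiable (by simp) p)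
    ((N.smooth p).mdifferentiableAt (by simp)) u
  have hη : ∀ i, S.η i (f p) (N.toFun p) = 0 := fun i ↦ by
    rw [S.η_eq, ← hf.mfderiv_ξ, N.normal]
  have h0 : (inner ℝ (S.φ (f p) (mfderiv 𝓘(ℝ, F) 𝓘(ℝ, E) f p u)) (N.toFun p) : ℝ) = 0 := by
    rw [← hf.mfderiv_φ, real_inner_comm, N.normal]
  rw [inner_mfderiv_shapeOperator, hf.mfderiv_φ, S.inner_φ_left, ← hf.mfderiv_φ,
    inner_mfderiv_shapeOperator]
  change _ = -inner ℝ (covAlong E F f (fun q ↦ S.φ (f q) (N.toFun q)) p u) _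
  -- Both terms of the formula for `(∇_u φ) N` vanish: one by `h0`, the other by `hη`.
  rw [h, inner_add_left, hS.inner_nablaφ, h0, S.inner_φ_left, hf.mfderiv_φ]
  simp [hη]

/-- `A_N φ = -A_{φ N}`. -/
lemma shapeOperator_φ (hS : S.IsGeneralizedKenmotsu n)
    (hf : IsInvariantSubmanifold (F := F) S f) (N : NormalField E F f)
    (u : TangentSpace 𝓘(ℝ, F) p) :
    shapeOperator hf.toIsImmersedSubmanifold (hf.φNormal N) p u =
      -shapeOperator hf.toIsImmersedSubmanifold N p (hf.φ p u) := by
  refine hf.ext_inner fun w ↦ ?_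
  -- `g(A_{φ N} u, w) = g(A_{φ N} w, u) = g(φ A_N w, u) = -g(A_N w, φ u) = -g(A_N (φ u), w)`.
  rw [inner_mfderiv_shapeOperator, NormalField.inner_covAlong_comm hf.smooth,
    ← inner_mfderiv_shapeOperator hf.toIsImmersedSubmanifold, ← shapeOperator_φNormal hS,
    hf.mfderiv_φ, S.inner_φ_left, ← hf.mfderiv_φ, inner_mfderiv_shapeOperator, map_neg,
    inner_neg_left, inner_mfderiv_shapeOperator, N.inner_covAlong_comm hf.smooth]

/-- `A_N ξ_i = 0`, since the vectors `∇_u ξ_i` are tangent to the submanifold. -/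
lemma shapeOperator_ξ (hS : S.IsGeneralizedKenmotsu n)
    (hf : IsInvariantSubmanifold (F := F) S f) (N : NormalField E F f) (i : Fin s) :
    shapeOperator hf.toIsImmersedSubmanifold N p (hf.ξ i p) = 0 := by
  refine hf.ext_inner fun w ↦ ?_
  have dN : MDiffAlongAt E F f N.toFun p := (N.smooth p).mdifferentiableAt (by simp)
  have df : MDifferentiableAt 𝓘(ℝ, F) 𝓘(ℝ, E) f p := hf.smooth.mdifferentiable (by simp) p
  have dξ := S.mdifferentiableAt_ξ (x := f p) i
  rw [inner_mfderiv_shapeOperator, N.inner_covAlong_comm hf.smooth, map_zero, inner_zero_left,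
    hf.mfderiv_ξ, neg_eq_zero]
  -- Differentiating `g(N, ξ_i) = 0` replaces `g(∇_w N, ξ_i)` by `-g(N, ∇_w ξ_i)`.
  have h := mvfderiv_inner_covAlong df dN (mdiffAlongAt_comp df dξ) w
  have h0 : (fun q ↦ (inner ℝ (N.toFun q) (S.ξ i (f q)) : ℝ)) = 0 := by
    funext q
    rw [← hf.mfderiv_ξ, N.normal]; rfl
  rw [h0, mvfderiv_zero, zero_apply, covAlong_comp f (S.ξ i) p df dξ] at h
  have hη : ∀ j, S.η j (f p) (N.toFun p) = 0 := fun j ↦ by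
    rw [S.η_eq, ← hf.mfderiv_ξ, N.normal]
  have hξ : ∀ j, (inner ℝ (N.toFun p) (S.ξ j (f p)) : ℝ) = 0 := fun j ↦ by
    rw [← hf.mfderiv_ξ, N.normal]
  set D := leviCivita E M (S.ξ i) (f p) (mfderiv 𝓘(ℝ, F) 𝓘(ℝ, E) f p w) with hD
  -- Since `(∇_w φ) ξ_i = -φ (∇_w ξ_i)`, pairing with `φ N` gives `-g(∇_w ξ_i, N)`, as `η(N) = 0`.
  -- The right side is zero because `η(φ N) = 0` and `g(φ w, φ N) = 0`.
  have h2 := hS.inner_nablaφ (mfderiv 𝓘(ℝ, F) 𝓘(ℝ, E) f p w) (S.ξ i (f p))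
    (S.φ (f p) (N.toFun p))
  have h3 : (inner ℝ (S.φ (f p) (mfderiv 𝓘(ℝ, F) 𝓘(ℝ, E) f p w)) (S.φ (f p) (N.toFun p)) : ℝ) = 0 := by
    rw [S.inner_φ_φ, real_inner_comm, N.normal]
    simp [hη]
  rw [S.nablaφ_ξ, ← hD, inner_neg_left, S.inner_φ_φ, h3] at h2
  simp only [hη, S.η_φ, mul_zero, zero_mul, Finset.sum_const_zero, sub_zero] at h2
  rw [real_inner_comm] at h2
  change 0 = _ + inner ℝ (N.toFun p) D at h
  linarith

end Symmetry

end

theorem mainTheorem8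
    {E : Type*} [NormedAddCommGroup E] [NormedSpace ℝ E] [FiniteDimensional ℝ E]
    {M : Type*} [TopologicalSpace M] [ChartedSpace E M] [IsManifold 𝓘(ℝ, E) ∞ M]
    [RiemannianBundle (fun x : M ↦ TangentSpace 𝓘(ℝ, E) x)]
    [IsContMDiffRiemannianBundle 𝓘(ℝ, E) ∞ E (fun x : M ↦ TangentSpace 𝓘(ℝ, E) x)]
    {F : Type*} [NormedAddCommGroup F] [NormedSpace ℝ F] [FiniteDimensional ℝ F]
    {P : Type*} [TopologicalSpace P] [ChartedSpace F P] [IsManifold 𝓘(ℝ, F) ∞ P]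
    {n s : ℕ} (S : MetricFStructure E M s) (hS : S.IsGeneralizedKenmotsu n)
    {f : P → M} (hf : IsInvariantSubmanifold (F := F) S f)
    (N : NormalField E F f) (p : P) :
    (∀ i : Fin s, shapeOperator hf.toIsImmersedSubmanifold N p (hf.ξ i p) = 0) ∧
    ∀ X : TangentSpace 𝓘(ℝ, F) p,
      hf.φ p (shapeOperator hf.toIsImmersedSubmanifold N p X) =
          shapeOperator hf.toIsImmersedSubmanifold (hf.φNormal N) p X ∧
      shapeOperator hf.toIsImmersedSubmanifold (hf.φNormal N) p X =
          -shapeOperator hf.toIsImmersedSubmanifold N p (hf.φ p X) := by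
  exact ⟨fun i ↦ shapeOperator_ξ hS hf N i,
    fun X ↦ ⟨shapeOperator_φNormal hS hf N X, shapeOperator_φ hS hf N X⟩⟩
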